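/- **Setting.** Alice prepares $n$ EPR pairs $(|00\rangle+|11\rangle)/\sqrt2$ and sends one half of each to Bob through a channel $\mathcal S\otimes I$, where $\mathcal S$ is an arbitrary (trace-preserving, completely positive) superoperator on an unknown set of at most $t$ of the transmitted qubits. In a (stabilizer) 2-EPP, Alice and Bob measure Pauli operators one after another, each on their own halves, and announce their outcomes after every measurement; each operator may depend on all earlier outcomes and commutes with all operators measured before. At the end each of them applies a unitary to their own qubits, which may depend on all the outcomes, and they keep some of the pairs and discard the others. The 2-EPP *produces at least $k$ perfect EPR pairs from $n$ pairs with up to $t$ arbitrary errors* if, for every such channel and all measurement outcomes, at least $k$ pairs are kept and the kept pairs are exactly (with fidelity 1) in the state of perfect EPR pairs. A measurement *detects an error* if Alice's and Bob's outcomes differ for at least one of the measured operators. **Theorem.** 1. There is a 2-EPP that produces at least $1$ perfect EPR pair from $9$ pairs with up to $2$ arbitrary errors. It can be chosen as follows. Alice and Bob measure the generators $XZZXI,\ IXZZX,\ XIXZZ,\ ZXIXZ$ of the five-qubit code on pairs 1–5 and then the generators $XXXX,\ ZZZZ$ of the four-qubit error-detecting code on pairs 6–9. * If they detect an error on pairs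 6–9, they discard these pairs and extract one pair from pairs 1–5. * If they detect an error on pairs 1–5 but none on pairs 6–9, they discard pairs 1–5 and extract two pairs from pairs 6–9. * If they detect no error, they discard pairs 6–9 and extract one pair from pairs 1–5. (Extracting pairs from a block means that both final unitaries act only on the qubits of this block and that only pairs of this block are kept.) 2. For $k=1$ and $t=2$, the quantum Hamming bound $2^k\sum_{j=0}^{t}3^j\binom nj\le 2^n$ holds exactly for $n\ge 10$; so the 2-EPP with $n=9$ exceeds it. 3. Every quantum error-correcting code that encodes one qubit in $n$ qubits and corrects up to $2$ arbitrary errors (that is, for which there are an isometric encoder and a recovery operation restoring every encoded state after any superoperator on any at most $2$ of the $n$ qubits) has $n\ge 11$; so the 2-EPP uses at least two pairs fewer than any such code uses qubits. -/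

import Mathlib

open scoped Kronecker Matrix

noncomputable section

namespace EPP

/-! ### Qubits and local operators -/

/-- Computational basis labels of qubits indexed by `ι`; operators on these qubits are
matrices indexed by `Qubits ι`. -/
abbrev Qubits (ι : Type) : Type := ι → Fin 2

/-- Basis labels of a bipartite register: Alice's half and Bob's half of each pair in `ι`. -/
abbrev Pairs (ι : Type) : Type := Qubits ι × Qubits ι

variable {n : ℕ}

/-- The operator `S ⊗ I`, with `S` acting on the qubits in `T` and `I` on the other qubits. -/
def localOp (T : Finset (Fin n)) (S : Matrix (Qubits T) (Qubits T) ℂ) :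
    Matrix (Qubits (Fin n)) (Qubits (Fin n)) ℂ :=
  fun x y => if ∀ i, i ∉ T → x i = y i then S (fun i => x i) (fun i => y i) else 0

/-- `S 0, …, S (m - 1)` are Kraus operators of a superoperator
`ρ ↦ ∑ i, S i * ρ * (S i)ᴴ` that preserves the trace. -/
def IsKraus {α β : Type} [Fintype α] [Fintype β] [DecidableEq α] {m : ℕ}
    (S : Fin m → Matrix β α ℂ) : Prop :=
  ∑ i, (S i)ᴴ * S i = 1

/-- The superoperator with the given Kraus operators. -/
def applyKraus {α β : Type} [Fintype α] [Fintype β] {m : ℕ}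
    (S : Fin m → Matrix β α ℂ) (ρ : Matrix α α ℂ) : Matrix β β ℂ :=
  ∑ i, S i * ρ * (S i)ᴴ

/-! ### Pauli operators -/

/-- The four single-qubit Pauli labels. -/
inductive Pauli
  | I
  | X
  | Y
  | Z

/-- The matrix of a single-qubit Pauli label. -/
def Pauli.toMatrix : Pauli → Matrix (Fin 2) (Fin 2) ℂ
  | .I => 1
  | .X => !![0, 1; 1, 0]
  | .Y => !![0, -Complex.I; Complex.I, 0]
  | .Z => !![1, 0; 0, -1]

/-- The tensor product `P 0 ⊗ … ⊗ P (n - 1)`. -/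
def pauliOp (P : Fin n → Pauli) : Matrix (Qubits (Fin n)) (Qubits (Fin n)) ℂ :=
  fun x y => ∏ i, (P i).toMatrix (x i) (y i)

/-- The projector onto the eigenspace of `pauliOp P` with eigenvalue `1` (outcome `false`)
or `-1` (outcome `true`). -/
def pauliProj (P : Fin n → Pauli) (a : Bool) : Matrix (Qubits (Fin n)) (Qubits (Fin n)) ℂ :=
  (1 / 2 : ℂ) • (1 + (if a then (-1 : ℂ) else 1) • pauliOp P)

/-! ### EPR pairs -/

/-- The state vector `(|00⟩ + |11⟩) / √2`. -/
def eprPair : Fin 2 × Fin 2 → ℂ := fun p => if p.1 = p.2 then ((1 / √2 : ℝ) : ℂ) else 0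

/-- The density matrix of perfect EPR pairs, one for each index in `ι`. -/
def eprState (ι : Type) [Fintype ι] : Matrix (Pairs ι) (Pairs ι) ℂ :=
  fun p q => (∏ i, eprPair (p.1 i, p.2 i)) * star (∏ i, eprPair (q.1 i, q.2 i))

/-- The basis label which is `x` on the qubits in `K` and `c` on the others. -/
def glue (K : Finset (Fin n)) (x : Qubits K) (c : Qubits {i // i ∉ K}) : Qubits (Fin n) :=
  fun i => if h : i ∈ K then x ⟨i, h⟩ else c ⟨i, h⟩

/-- The reduced state on the pairs in `K`: both halves of every other pair are traced out. -/
def reducedState (K : Finset (Fin n)) (ρ : Matrix (Pairs (Fin n)) (Pairs (Fin n)) ℂ) :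
    Matrix (Pairs K) (Pairs K) ℂ :=
  fun p q => ∑ c : Pairs {i // i ∉ K},
    ρ (glue K p.1 c.1, glue K p.2 c.2) (glue K q.1 c.1, glue K q.2 c.2)

/-! ### Two-way entanglement purification protocols -/

/-- What Alice and Bob do after their last measurement: Alice applies `UA` to her qubits,
Bob applies `UB` to his, they keep the pairs in `keep` and discard all others. -/
structure Extraction (n : ℕ) where
  UA : Matrix.unitaryGroup (Qubits (Fin n)) ℂ
  UB : Matrix.unitaryGroup (Qubits (Fin n)) ℂ
  keep : Finset (Fin n)

/-- A (stabilizer) 2-EPP on `n` pairs. In `measure M next`, Alice and Bob each measure the Pauli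
operator `M` on their own halves and tell each other their outcomes `a` (Alice) and `b` (Bob);
they continue with `next a b`, so that later measurements and the final extraction may depend on
all outcomes so far. -/
inductive TwoEPP (n : ℕ) : Type
  | extract (e : Extraction n) : TwoEPP n
  | measure (M : Fin n → Pauli) (next : Bool → Bool → TwoEPP n) : TwoEPP n

namespace TwoEPP

/-- Every operator measured commutes with those in `prev` and with all operators measured
before it in the protocol. -/
def CommutingAfter : List (Fin n → Pauli) → TwoEPP n → Prop
  | _, extract _ => True
  | prev, measure M next =>
      (∀ P ∈ prev, Commute (pauliOp P) (pauliOp M)) ∧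
        ∀ a b, CommutingAfter (M :: prev) (next a b)

/-- All operators measured in one run of the protocol commute with each other. -/
def Commuting (π : TwoEPP n) : Prop := π.CommutingAfter []

/-- Run on the unnormalized state `ρ` (its trace is the probability of the outcomes
that led to it), the protocol always ends with at least `k` kept pairs,
and these are in the state of perfect EPR pairs, for all outcomes of the measurements. -/
def Succeeds (k : ℕ) : TwoEPP n → Matrix (Pairs (Fin n)) (Pairs (Fin n)) ℂ → Prop
  | extract e, ρ =>
      k ≤ e.keep.card ∧
        reducedState e.keep
            ((e.UA.1 ⊗ₖ e.UB.1) * ρ * (e.UA.1 ⊗ₖ e.UB.1)ᴴ) =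
          ρ.trace • eprState e.keep
  | measure M next, ρ =>
      ∀ a b, Succeeds k (next a b)
        ((pauliProj M a ⊗ₖ pauliProj M b) * ρ * (pauliProj M a ⊗ₖ pauliProj M b)ᴴ)

/-- The protocol produces at least `k` perfect EPR pairs from `n` pairs with up to `t` arbitrary
errors: it succeeds whenever Bob's halves of `n` perfect EPR pairs went through a channel
`𝒮 ⊗ id`, where `𝒮` is any superoperator on a set `T` of at most `t` qubits. -/
def Produces (π : TwoEPP n) (k t : ℕ) : Prop :=
  ∀ T : Finset (Fin n), T.card ≤ t →
    ∀ (m : ℕ) (S : Fin m → Matrix (Qubits T) (Qubits T) ℂ), IsKraus S →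
      π.Succeeds k
        (applyKraus (fun i => (1 : Matrix (Qubits (Fin n)) (Qubits (Fin n)) ℂ) ⊗ₖ
          localOp T (S i)) (eprState (Fin n)))

/-- Measure the listed operators in order, then continue according to the record of all
outcome pairs (Alice's outcome, Bob's outcome). -/
def measureAll : List (Fin n → Pauli) → (List (Bool × Bool) → TwoEPP n) → TwoEPP n
  | [], next => next []
  | M :: L, next => measure M fun a b => measureAll L fun r => next ((a, b) :: r)

end TwoEPP

/-- The extraction acts only on the block `B`: both unitaries act on the qubits in `B`, and
only pairs in `B` are kept. -/
def Extraction.From (e : Extraction n) (B : Finset (Fin n)) : Prop :=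
  e.keep ⊆ B ∧ (∃ S, e.UA.1 = localOp B S) ∧ ∃ S, e.UB.1 = localOp B S

/-- The record of outcome pairs reveals an error: for one of the operators, Alice's and Bob's
outcomes differ. (On perfect EPR pairs the outcomes agree for every Pauli operator with an even
number of `Y`s, in particular for the generators below.) -/
def ErrorDetected (r : List (Bool × Bool)) : Prop := ∃ p ∈ r, p.1 ≠ p.2

/-! ### The two codes in the nine-pair protocol -/

open Pauli in
/-- The generators of the five-qubit code on the first five of nine pairs. -/
def fiveQubitGenerators : List (Fin 9 → Pauli) :=
  [![X, Z, Z, X, I, I, I, I, I],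
   ![I, X, Z, Z, X, I, I, I, I],
   ![X, I, X, Z, Z, I, I, I, I],
   ![Z, X, I, X, Z, I, I, I, I]]

open Pauli in
/-- The generators of the four-qubit error-detecting code on the last four of nine pairs. -/
def fourQubitGenerators : List (Fin 9 → Pauli) :=
  [![I, I, I, I, I, X, X, X, X],
   ![I, I, I, I, I, Z, Z, Z, Z]]

/-- The first five pairs. -/
def firstFive : Finset (Fin 9) := {0, 1, 2, 3, 4}

/-- The last four pairs. -/
def lastFour : Finset (Fin 9) := {5, 6, 7, 8}

/-! ### Quantum error-correcting codes -/

/-- The inequality of the quantum Hamming bound for `n` qubits, `k` encoded qubits and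
`t` errors. -/
def QuantumHammingBound (n k t : ℕ) : Prop :=
  2 ^ k * ∑ j ∈ Finset.range (t + 1), 3 ^ j * n.choose j ≤ 2 ^ n

/-- There is a quantum error-correcting code that encodes `k` qubits in `n` qubits and corrects
up to `t` arbitrary errors: an isometric encoder `V` and a recovery operation `R` that restores
every encoded state after any superoperator on any set `T` of at most `t` qubits. -/
def ExistsQECC (n k t : ℕ) : Prop :=
  ∃ (V : Matrix (Qubits (Fin n)) (Qubits (Fin k)) ℂ) (r : ℕ)
    (R : Fin r → Matrix (Qubits (Fin k)) (Qubits (Fin n)) ℂ),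
    Vᴴ * V = 1 ∧ IsKraus R ∧
      ∀ T : Finset (Fin n), T.card ≤ t →
        ∀ (m : ℕ) (S : Fin m → Matrix (Qubits T) (Qubits T) ℂ), IsKraus S →
          ∀ ρ : Matrix (Qubits (Fin k)) (Qubits (Fin k)) ℂ,
            applyKraus R (applyKraus (fun i => localOp T (S i)) (V * ρ * Vᴴ)) = ρ

end EPP

end

/-! Purification. Alice and Bob choose which block to keep after learning where errors showed up,
and two errors cannot spoil every choice. If the four-qubit code reports an error, at most one error
is left for pairs 1–5, and the five-qubit code, of distance 3, identifies it. If only the five-qubit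
code reports, at most one error can be on pairs 6–9, where the distance-2 code would have seen it.
If neither reports, at most two errors on pairs 1–5 went unseen by a distance-3 code, so there are
none. This is `exists_recovering_extraction`.

To make this exact, a bipartite pure state is written as its coefficient matrix `M`, on which `A ⊗
B` acts by `M ↦ A * M * Bᵀ`. Perfect pairs are a multiple of `1`, so Bob's Kraus operators turn into
their transposes. Measuring real commuting Pauli operators puts projectors on both sides; a Pauli
error `E` then yields `E` times a stabilizer projector if its syndrome equals the discrepancy of the
outcomes, and `0` otherwise (`jointProj_sandwich`). The pairs in `K` are perfect as soon as the
final matrix acts only outside `K` (`reducedState_pureState`). This condition is linear in the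
error, so Pauli errors suffice (`Recovers.localOp`). A suitable final unitary exists because the
projector has the same rank as one fixing the block's qubits outside `K` to `0` (`exists_decoder`).

Lower bound for codes. Correcting two errors forces every Pauli operator of weight at most 4 to act
as a scalar on the code (`exists_compress_eq_smul_one`). The weight enumerator therefore satisfies
the MacWilliams equations in degrees 0 to 4 (`enumerator_of_scalar`). It is also nonnegative and
obeys the shadow inequalities (`shadow_enumerator_nonneg`). For `n ≤ 10` this linear program has no
solution. -/

noncomputable section

namespace EPP

/-! ### Operators on qubits in the Pauli basis -/

section

/-! ### Tensor products of single-qubit operators -/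

section Tensor

variable {ι : Type} [Fintype ι]

/-- The tensor product of single-qubit operators. -/
def tens (A : ι → Matrix (Fin 2) (Fin 2) ℂ) : Matrix (Qubits ι) (Qubits ι) ℂ :=
  fun x y => ∏ i, A i (x i) (y i)

theorem tens_mul [DecidableEq ι] (A B : ι → Matrix (Fin 2) (Fin 2) ℂ) :
    tens A * tens B = tens (fun i => A i * B i) := by
  ext x y
  simp only [tens, Matrix.mul_apply, ← Finset.prod_mul_distrib]
  rw [Finset.prod_univ_sum, Fintype.piFinset_univ]

theorem tens_one [DecidableEq ι] :
    tens (fun _ : ι => (1 : Matrix (Fin 2) (Fin 2) ℂ)) = 1 := by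
  ext x y
  simp only [tens, Matrix.one_apply, Finset.prod_ite_zero, Finset.mem_univ, forall_true_left,
    Finset.prod_const_one, funext_iff]

theorem tens_smul (c : ι → ℂ) (A : ι → Matrix (Fin 2) (Fin 2) ℂ) :
    tens (fun i => c i • A i) = (∏ i, c i) • tens A := by
  ext x y
  simp [tens, Finset.prod_mul_distrib]

theorem tens_conjTranspose (A : ι → Matrix (Fin 2) (Fin 2) ℂ) :
    (tens A)ᴴ = tens (fun i => (A i)ᴴ) := by
  ext x y
  simp [tens, Matrix.conjTranspose_apply]

theorem tens_transpose (A : ι → Matrix (Fin 2) (Fin 2) ℂ) :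
    (tens A)ᵀ = tens (fun i => (A i)ᵀ) := rfl

end Tensor

/-! ### Pauli operators -/

instance : DecidableEq Pauli := fun a b =>
  decidable_of_iff (a.ctorIdx = b.ctorIdx) (by cases a <;> cases b <;> simp [Pauli.ctorIdx])

instance : Fintype Pauli :=
  ⟨⟨([.I, .X, .Y, .Z] : List Pauli), by decide⟩, by rintro (_ | _ | _ | _) <;> decide⟩

theorem sum_pauli {M : Type*} [AddCommMonoid M] (f : Pauli → M) :
    ∑ p, f p = f .I + f .X + f .Y + f .Z := by
  change (Multiset.map f ↑[Pauli.I, .X, .Y, .Z]).sum = _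
  simp [add_assoc]

/-- The sign with which two single-qubit Pauli operators commute. -/
def Pauli.sgn : Pauli → Pauli → ℤ
  | .I, _ => 1
  | _, .I => 1
  | p, q => if p = q then 1 else -1

theorem Pauli.toMatrix_mul_comm (p q : Pauli) :
    p.toMatrix * q.toMatrix = (p.sgn q : ℂ) • (q.toMatrix * p.toMatrix) := by
  cases p <;> cases q <;> ext i j <;> fin_cases i <;> fin_cases j <;>
    simp [Pauli.toMatrix, Pauli.sgn]

theorem Pauli.toMatrix_sq (p : Pauli) : p.toMatrix * p.toMatrix = 1 := by
  cases p <;> ext i j <;> fin_cases i <;> fin_cases j <;> simp [Pauli.toMatrix]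

theorem Pauli.conjTranspose_toMatrix (p : Pauli) : (p.toMatrix)ᴴ = p.toMatrix := by
  cases p <;> ext i j <;> fin_cases i <;> fin_cases j <;>
    simp [Pauli.toMatrix, Matrix.conjTranspose_apply]

theorem Pauli.transpose_toMatrix (p : Pauli) :
    (p.toMatrix)ᵀ = ((if p = .Y then -1 else 1 : ℤ) : ℂ) • p.toMatrix := by
  cases p <;> ext i j <;> fin_cases i <;> fin_cases j <;>
    simp [Pauli.toMatrix]

theorem Pauli.sum_toMatrix (a b c d : Fin 2) :
    ∑ p : Pauli, p.toMatrix a b * p.toMatrix c d = if a = d ∧ b = c then 2 else 0 := by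
  rw [sum_pauli]
  fin_cases a <;> fin_cases b <;> fin_cases c <;> fin_cases d <;>
    simp [Pauli.toMatrix] <;> norm_num

variable {ι : Type} [Fintype ι]

/-- The tensor product of Pauli operators on qubits indexed by `ι`. -/
def pauliTens (P : ι → Pauli) : Matrix (Qubits ι) (Qubits ι) ℂ :=
  tens fun i => (P i).toMatrix

theorem pauliTens_conjTranspose (P : ι → Pauli) : (pauliTens P)ᴴ = pauliTens P := by
  simp only [pauliTens, tens_conjTranspose, Pauli.conjTranspose_toMatrix]

theorem pauliTens_transpose (P : ι → Pauli) :
    (pauliTens P)ᵀ = ((∏ i, if P i = .Y then -1 else 1 : ℤ) : ℂ) • pauliTens P := by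
  simp only [pauliTens, tens_transpose, Pauli.transpose_toMatrix, Int.cast_prod, ← tens_smul]

/-- The sign with which two Pauli operators commute. -/
def pauliSgn (P Q : ι → Pauli) : ℤ := ∏ i, (P i).sgn (Q i)

theorem Pauli.sgn_eq (p q : Pauli) : p.sgn q = 1 ∨ p.sgn q = -1 := by
  revert p q; decide

theorem pauliSgn_eq (P Q : ι → Pauli) : pauliSgn P Q = 1 ∨ pauliSgn P Q = -1 := by
  rw [← Int.isUnit_iff, pauliSgn, IsUnit.prod_univ_iff]
  exact fun i => Int.isUnit_iff.2 (Pauli.sgn_eq _ _)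

variable [DecidableEq ι]

variable {n : ℕ}

theorem pauliOp_eq (P : Fin n → Pauli) : pauliOp P = pauliTens P := rfl

theorem pauliTens_mul_comm (P Q : ι → Pauli) :
    pauliTens P * pauliTens Q = (pauliSgn P Q : ℂ) • (pauliTens Q * pauliTens P) := by
  simp only [pauliTens, tens_mul, pauliSgn, Int.cast_prod, ← tens_smul]
  congr 1
  funext i
  exact Pauli.toMatrix_mul_comm _ _

theorem pauliTens_sq (P : ι → Pauli) : pauliTens P * pauliTens P = 1 := by
  simp only [pauliTens, tens_mul, Pauli.toMatrix_sq, tens_one]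

/-- Pauli operators form a basis: the completeness relation. -/
theorem sum_pauliTens (x y z w : Qubits ι) :
    ∑ F : ι → Pauli, pauliTens F x y * pauliTens F z w =
      if x = w ∧ y = z then (2 : ℂ) ^ Fintype.card ι else 0 := by
  simp only [pauliTens, tens, ← Finset.prod_mul_distrib]
  rw [← Fintype.piFinset_univ,
    ← Finset.prod_univ_sum (fun _ => Finset.univ)
      (fun i (p : Pauli) => p.toMatrix (x i) (y i) * p.toMatrix (z i) (w i))]
  simp only [Pauli.sum_toMatrix, Finset.prod_ite_zero, Finset.prod_const, Finset.card_univ]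
  simp only [funext_iff, ← forall_and, Finset.mem_univ, forall_true_left]

theorem pauli_expansion (M : Matrix (Qubits ι) (Qubits ι) ℂ) :
    (2 : ℂ) ^ Fintype.card ι • M = ∑ F : ι → Pauli, (pauliTens F * M).trace • pauliTens F := by
  ext x y
  simp only [Matrix.sum_apply, Matrix.smul_apply, Matrix.trace, Matrix.diag, Matrix.mul_apply,
    smul_eq_mul, Finset.sum_mul]
  rw [Finset.sum_comm]
  have : ∀ z w : Qubits ι, ∑ F : ι → Pauli, pauliTens F z w * M w z * pauliTens F x y =
      if x = w ∧ y = z then (2 : ℂ) ^ Fintype.card ι * M w z else 0 := by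
    intro z w
    have h := congrArg (· * M w z) (sum_pauliTens x y z w)
    simp only [Finset.sum_mul, ite_mul, zero_mul] at h
    rw [← h]
    exact Finset.sum_congr rfl fun _ _ => by ring
  simp_rw [Finset.sum_comm (γ := ι → Pauli), this, ite_and]
  simp

theorem mem_span_pauliTens (M : Matrix (Qubits ι) (Qubits ι) ℂ) :
    M ∈ Submodule.span ℂ (Set.range (pauliTens (ι := ι))) := by
  have h : M = ((2 : ℂ) ^ Fintype.card ι)⁻¹ •
      ∑ F : ι → Pauli, (pauliTens F * M).trace • pauliTens F := by
    rw [← pauli_expansion, smul_smul, inv_mul_cancel₀ (pow_ne_zero _ two_ne_zero), one_smul]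
  rw [h]
  exact Submodule.smul_mem _ _ (Submodule.sum_mem _ fun F _ =>
    Submodule.smul_mem _ _ (Submodule.subset_span ⟨F, rfl⟩))

/-! ### Local operators -/

/-- The Pauli operator on `T` extended by the identity. -/
def extendPauli (T : Finset (Fin n)) (P : T → Pauli) (i : Fin n) : Pauli :=
  if h : i ∈ T then P ⟨i, h⟩ else .I

theorem localOp_pauliTens (T : Finset (Fin n)) (P : T → Pauli) :
    localOp T (pauliTens P) = pauliTens (extendPauli T P) := by
  ext x y
  simp only [localOp, pauliTens, tens]
  rw [← Finset.prod_mul_prod_compl T, ← Finset.prod_coe_sort T]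
  have h1 : ∀ i : T, (extendPauli T P i).toMatrix (x i) (y i) = (P i).toMatrix (x i) (y i) := by
    intro i; simp [extendPauli]
  have h2 : ∀ i ∈ Tᶜ, (extendPauli T P i).toMatrix (x i) (y i) =
      if x i = y i then 1 else 0 := by
    intro i hi
    simp [extendPauli, Finset.mem_compl.1 hi, Pauli.toMatrix, Matrix.one_apply]
  rw [Finset.prod_congr rfl h2, Finset.prod_ite_zero]
  simp only [h1, Finset.mem_compl, Finset.prod_const_one, mul_ite, mul_one, mul_zero]

theorem localOp_add (T : Finset (Fin n)) (A B : Matrix (Qubits T) (Qubits T) ℂ) :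
    localOp T (A + B) = localOp T A + localOp T B := by
  ext x y; simp only [localOp, Matrix.add_apply]; split_ifs <;> simp

theorem localOp_smul (T : Finset (Fin n)) (c : ℂ) (A : Matrix (Qubits T) (Qubits T) ℂ) :
    localOp T (c • A) = c • localOp T A := by
  ext x y; simp only [localOp, Matrix.smul_apply]; split_ifs <;> simp

/-- `localOp T` as a linear map. -/
def localOpLin (T : Finset (Fin n)) :
    Matrix (Qubits T) (Qubits T) ℂ →ₗ[ℂ] Matrix (Qubits (Fin n)) (Qubits (Fin n)) ℂ where
  toFun := localOp T
  map_add' := localOp_add T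
  map_smul' := localOp_smul T

/-- Induction principle: a linear property of local operators has to be checked only
for Pauli operators. -/
theorem localOp_mem (T : Finset (Fin n))
    (W : Submodule ℂ (Matrix (Qubits (Fin n)) (Qubits (Fin n)) ℂ))
    (hW : ∀ F : Fin n → Pauli, (∀ i, i ∉ T → F i = .I) → pauliOp F ∈ W)
    (A : Matrix (Qubits T) (Qubits T) ℂ) : localOp T A ∈ W := by
  have h : Submodule.span ℂ (Set.range (pauliTens (ι := T))) ≤ W.comap (localOpLin T) := by
    rw [Submodule.span_le]
    rintro _ ⟨P, rfl⟩
    change localOp T (pauliTens P) ∈ W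
    rw [localOp_pauliTens]
    exact hW _ fun i hi => by simp [extendPauli, hi]
  exact h (mem_span_pauliTens A)

theorem exists_localOp_eq_pauliOp (T : Finset (Fin n)) (F : Fin n → Pauli)
    (hF : ∀ i, i ∉ T → F i = .I) : pauliOp F = localOp T (pauliTens fun i : T => F i) := by
  rw [localOp_pauliTens, pauliOp_eq]
  congr 1
  funext i
  by_cases h : i ∈ T <;> simp [extendPauli, h, hF]

end

/-! ### Lower bound for codes: scalar action of errors and enumerator identities -/

section

/-! ### Quantum codes: the Knill–Laflamme condition -/

/-- The Kraus operators of the identity channel are scalars. -/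
theorem exists_eq_smul_one_of_applyKraus {κ : Type} [Fintype κ] [DecidableEq κ] [Nonempty κ]
    {r : ℕ} (A : Fin r → Matrix κ κ ℂ) (h : ∀ ρ, applyKraus A ρ = ρ) (i : Fin r) :
    ∃ c : ℂ, A i = c • 1 := by
  -- The channel is evaluated on the matrix unit `Matrix.single a b 1`.
  have key : ∀ x a y b : κ, ∑ i, A i x a * star (A i y b) =
      if a = x ∧ b = y then 1 else 0 := by
    intro x a y b
    have := congrFun (congrFun (h (Matrix.single a b 1)) x) y
    simp only [applyKraus, Matrix.sum_apply] at this
    rw [Matrix.single_apply] at this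
    rw [← this]
    refine Finset.sum_congr rfl fun i _ => ?_
    simp [Matrix.mul_apply, Matrix.single_apply, Matrix.conjTranspose_apply, ite_and]
  have hsq : ∀ f : Fin r → ℂ, ∑ i, f i * star (f i) = 0 → ∀ i, f i = 0 := by
    intro f hf i
    have h0 : ∑ i, ‖f i‖ ^ 2 = 0 := by
      have : ((∑ i, ‖f i‖ ^ 2 : ℝ) : ℂ) = 0 := by
        rw [← hf]
        push_cast
        exact Finset.sum_congr rfl fun i _ => by
          rw [← Complex.mul_conj' (f i)]; rfl
      exact_mod_cast this
    have := (Finset.sum_eq_zero_iff_of_nonneg fun i _ => by positivity).1 h0 i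
      (Finset.mem_univ i)
    simpa using this
  have hoff : ∀ x a, a ≠ x → A i x a = 0 := fun x a hxa =>
    hsq (fun i => A i x a) (by simpa [hxa] using key x a x a) i
  -- By `key`, the squared norm of the vector of differences expands to 1 - 1 - 1 + 1 = 0.
  have hdiag : ∀ a b, A i a a = A i b b := by
    intro a b
    have := hsq (fun i => A i a a - A i b b) (by
      simp only [star_sub, sub_mul, mul_sub, Finset.sum_sub_distrib, key]
      simp) i
    exact sub_eq_zero.1 this
  obtain ⟨o⟩ := ‹Nonempty κ›
  refine ⟨A i o o, ?_⟩
  ext x a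
  by_cases hxa : a = x
  · subst hxa; simp [hdiag a o]
  · simp [hoff x a hxa, Ne.symm hxa]

/-- The number of qubits on which a Pauli operator acts nontrivially. -/
def wt {ι : Type} [Fintype ι] (F : ι → Pauli) : ℕ := (Finset.univ.filter fun i => F i ≠ .I).card

/-- Errors of weight at most `2 * t` act on the code space as scalars. -/
theorem exists_compress_eq_smul_one {n k t : ℕ} (V : Matrix (Qubits (Fin n)) (Qubits (Fin k)) ℂ)
    {r : ℕ} (R : Fin r → Matrix (Qubits (Fin k)) (Qubits (Fin n)) ℂ) (hR : IsKraus R)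
    (h : ∀ T : Finset (Fin n), T.card ≤ t →
        ∀ (m : ℕ) (S : Fin m → Matrix (Qubits T) (Qubits T) ℂ), IsKraus S →
          ∀ ρ : Matrix (Qubits (Fin k)) (Qubits (Fin k)) ℂ,
            applyKraus R (applyKraus (fun i => localOp T (S i)) (V * ρ * Vᴴ)) = ρ)
    (E : Fin n → Pauli) (hE : wt E ≤ t + t) : ∃ c : ℂ, Vᴴ * pauliTens E * V = c • 1 := by
  have hsc : ∀ F : Fin n → Pauli, wt F ≤ t →
      ∃ c : Fin r → ℂ, ∀ i, R i * pauliTens F * V = c i • 1 := by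
    intro F hF
    set T := Finset.univ.filter fun i => F i ≠ .I with hT
    have hloc : localOp T (pauliTens fun i : T => F i) = pauliTens F := by
      rw [← exists_localOp_eq_pauliOp, pauliOp_eq]
      intro i hi
      simpa [hT] using hi
    -- A Pauli operator is unitary, hence a channel with a single Kraus operator.
    have h1 := h T hF 1 (fun _ => pauliTens fun i : T => F i) (by
      simp [IsKraus, pauliTens_conjTranspose, pauliTens_sq])
    have h2 : ∀ ρ, applyKraus (fun i => R i * pauliTens F * V) ρ = ρ := by
      intro ρ
      refine Eq.trans ?_ (h1 ρ)
      simp only [applyKraus, hloc, Finset.univ_unique, Finset.sum_singleton]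
      simp [Matrix.conjTranspose_mul, Matrix.mul_assoc]
    choose c hc using exists_eq_smul_one_of_applyKraus _ h2
    exact ⟨c, hc⟩
  -- The support of `E` is cut into `min t (wt E)` positions and a remainder of at most `t`; `E` is
  -- the product of two correctable errors.
  obtain ⟨T, hTE, hT⟩ := Finset.exists_subset_card_eq
    (min_le_right t (Finset.univ.filter fun i => E i ≠ .I).card)
  set E₁ : Fin n → Pauli := fun i => if i ∈ T then E i else .I
  set E₂ : Fin n → Pauli := fun i => if i ∈ T then .I else E i
  have hE12 : pauliTens E = pauliTens E₁ * pauliTens E₂ := by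
    simp only [pauliTens, tens_mul]
    congr 1
    funext i
    by_cases hi : i ∈ T <;> simp [E₁, E₂, hi, Pauli.toMatrix]
  have hw1 : wt E₁ ≤ t := by
    refine (Finset.card_le_card (t := T) ?_).trans (hT.le.trans (min_le_left _ _))
    intro i hi
    by_contra hi'
    simp [E₁, hi'] at hi
  have hw2 : wt E₂ ≤ t := by
    have : wt E₂ ≤ (Finset.univ.filter fun i => E i ≠ .I).card - T.card := by
      rw [← Finset.card_sdiff_of_subset hTE]
      refine Finset.card_le_card ?_
      intro i hi
      by_cases hi' : i ∈ T <;> simp [E₂, hi'] at hi ⊢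
      exact hi
    unfold wt at hE
    omega
  obtain ⟨c, hc⟩ := hsc E₁ hw1
  obtain ⟨d, hd⟩ := hsc E₂ hw2
  refine ⟨∑ i, star (c i) * d i, ?_⟩
  -- Inserting `∑ (R i)ᴴ * R i = 1` between the two factors leaves only products of scalars.
  calc Vᴴ * pauliTens E * V = Vᴴ * pauliTens E₁ * (∑ i, (R i)ᴴ * R i) * (pauliTens E₂ * V) := by
        rw [hE12, hR]; simp [Matrix.mul_assoc]
    _ = ∑ i, (R i * pauliTens E₁ * V)ᴴ * (R i * pauliTens E₂ * V) := by
        simp [Matrix.mul_sum, Matrix.sum_mul, Matrix.conjTranspose_mul, pauliTens_conjTranspose,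
          Matrix.mul_assoc]
    _ = (∑ i, star (c i) * d i) • 1 := by
        simp [hc, hd, Finset.sum_smul, Matrix.conjTranspose_smul, smul_smul, mul_comm]

/-! ### Weight enumerators -/

section Enumerators

variable {ι κ : Type} [Fintype ι] [Fintype κ]

theorem sign_wt (F : ι → Pauli) :
    (-1 : ℤ) ^ wt F = ∏ i, if F i = .I then 1 else -1 := by
  rw [wt, ← Finset.prod_const, Finset.prod_filter]
  refine Finset.prod_congr rfl fun i _ => ?_
  by_cases h : F i = .I <;> simp [h]

variable [DecidableEq ι]

/-- The compression of a Pauli operator to the code space. -/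
def compress (V : Matrix (Qubits ι) κ ℂ) (E : ι → Pauli) : Matrix κ κ ℂ :=
  Vᴴ * pauliTens E * V

theorem trace_mul_expansion (M N : Matrix (Qubits ι) (Qubits ι) ℂ) :
    (2 : ℂ) ^ Fintype.card ι * (M * N).trace =
      ∑ F : ι → Pauli, (pauliTens F * M).trace * (pauliTens F * N).trace := by
  rw [← smul_eq_mul, ← Matrix.trace_smul, ← Matrix.smul_mul, pauli_expansion, Matrix.sum_mul,
    Matrix.trace_sum]
  simp [Matrix.trace_smul]

theorem trace_compress (V : Matrix (Qubits ι) κ ℂ) (E : ι → Pauli) :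
    (compress V E).trace = (pauliTens E * (V * Vᴴ)).trace := by
  rw [compress, Matrix.mul_assoc, Matrix.trace_mul_comm, Matrix.mul_assoc]

theorem trace_compress_im (V : Matrix (Qubits ι) κ ℂ) (E : ι → Pauli) :
    (compress V E).trace = ((compress V E).trace.re : ℂ) := by
  have h : (compress V E)ᴴ = compress V E := by
    simp [compress, Matrix.conjTranspose_mul, pauliTens_conjTranspose, Matrix.mul_assoc]
  have h2 := Matrix.trace_conjTranspose (compress V E)
  rw [h] at h2
  exact (Complex.conj_eq_iff_re.1 h2.symm).symm

theorem pauliTens_conj (E F : ι → Pauli) :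
    pauliTens E * pauliTens F * pauliTens E = (pauliSgn E F : ℂ) • pauliTens F := by
  rw [pauliTens_mul_comm, Matrix.smul_mul, Matrix.mul_assoc, pauliTens_sq, Matrix.mul_one]

/-- With `P = V * Vᴴ`, the left side is the trace of `P * (E * P * E)`. In the Pauli expansion,
conjugation by `E` only changes the coefficient of `F` by the commutation sign. -/
theorem macWilliams_complex (V : Matrix (Qubits ι) κ ℂ) (E : ι → Pauli) :
    (2 : ℂ) ^ Fintype.card ι * (compress V E * compress V E).trace =
      ∑ F : ι → Pauli, (pauliSgn E F : ℂ) * (compress V F).trace ^ 2 := by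
  have h : (compress V E * compress V E).trace =
      ((V * Vᴴ) * (pauliTens E * (V * Vᴴ) * pauliTens E)).trace := by
    simp only [compress]
    rw [Matrix.trace_mul_comm (V * Vᴴ)]
    simp only [Matrix.mul_assoc]
    rw [Matrix.trace_mul_comm]
    simp only [Matrix.mul_assoc]
  rw [h, trace_mul_expansion]
  refine Finset.sum_congr rfl fun F _ => ?_
  have h2 : (pauliTens F * (pauliTens E * (V * Vᴴ) * pauliTens E)).trace =
      (pauliSgn E F : ℂ) * (compress V F).trace := by
    have e : (pauliTens F * (pauliTens E * (V * Vᴴ) * pauliTens E)).trace =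
        (pauliTens E * pauliTens F * pauliTens E * (V * Vᴴ)).trace := by
      rw [← Matrix.mul_assoc, Matrix.trace_mul_comm]
      simp only [Matrix.mul_assoc]
    rw [e, pauliTens_conj, Matrix.smul_mul, Matrix.trace_smul, smul_eq_mul, trace_compress]
  rw [h2, trace_compress]
  ring

/-- On one qubit, conjugation by `Y` negates `X` and `Z`, while transposition negates `Y`; together
they negate all three nontrivial Paulis. This is the source of the signs in the shadow. -/
theorem pauliTens_spinFlip (F : ι → Pauli) :
    pauliTens (fun _ : ι => Pauli.Y) * pauliTens F * pauliTens (fun _ : ι => Pauli.Y) =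
      ((-1 : ℤ) ^ wt F : ℂ) • (pauliTens F)ᵀ := by
  rw [pauliTens_transpose, pauliTens_conj, smul_smul]
  congr 1
  have : pauliSgn (fun _ : ι => Pauli.Y) F =
      (-1 : ℤ) ^ wt F * (∏ i, if F i = .Y then -1 else 1 : ℤ) := by
    rw [sign_wt, pauliSgn, ← Finset.prod_mul_distrib]
    refine Finset.prod_congr rfl fun i _ => ?_
    cases F i <;> decide
  exact_mod_cast this

/-- Replacing one copy of `P = V * Vᴴ` by its spin flip puts the sign `(-1) ^ wt F` into the
MacWilliams sum. The trace of a product of two positive operators remains, and it is the squared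
Hilbert–Schmidt norm of `N`. -/
theorem shadow_complex (V : Matrix (Qubits ι) κ ℂ) (E : ι → Pauli) :
    ∃ N : Matrix κ κ ℂ, ∑ F : ι → Pauli,
      (pauliSgn E F : ℂ) * (((-1 : ℤ) ^ wt F : ℂ) * (compress V F).trace ^ 2) =
        (2 : ℂ) ^ Fintype.card ι * (N * Nᴴ).trace := by
  set Y := pauliTens (fun _ : ι => Pauli.Y) with hY
  set W := pauliTens E * Y with hW
  have hW' : Wᴴ = Y * pauliTens E := by
    rw [hW, Matrix.conjTranspose_mul, pauliTens_conjTranspose, hY, pauliTens_conjTranspose]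
  refine ⟨Vᴴ * W * Vᴴᵀ, ?_⟩
  have h : (Vᴴ * W * Vᴴᵀ * (Vᴴ * W * Vᴴᵀ)ᴴ).trace =
      ((V * Vᴴ) * (W * (V * Vᴴ)ᵀ * Wᴴ)).trace := by
    have e : (Vᴴᵀ)ᴴ = Vᵀ := by ext; simp [Matrix.conjTranspose_apply]
    simp only [Matrix.conjTranspose_mul, Matrix.transpose_mul, e,
      Matrix.conjTranspose_conjTranspose]
    rw [Matrix.mul_assoc V, Matrix.trace_mul_comm V]
    simp only [Matrix.mul_assoc]
  rw [h, trace_mul_expansion]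
  refine Finset.sum_congr rfl fun F _ => ?_
  have h2 : (pauliTens F * (W * (V * Vᴴ)ᵀ * Wᴴ)).trace =
      (pauliSgn E F : ℂ) * (((-1 : ℤ) ^ wt F : ℂ) * (compress V F).trace) := by
    have e1 : (pauliTens F * (W * (V * Vᴴ)ᵀ * Wᴴ)).trace =
        (Y * (pauliTens E * pauliTens F * pauliTens E) * Y * (V * Vᴴ)ᵀ).trace := by
      rw [← Matrix.mul_assoc, Matrix.trace_mul_comm, hW', hW]
      simp only [Matrix.mul_assoc]
    rw [e1, pauliTens_conj, Matrix.mul_smul, Matrix.smul_mul, Matrix.smul_mul, Matrix.trace_smul,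
      smul_eq_mul]
    congr 1
    rw [pauliTens_spinFlip, Matrix.smul_mul, Matrix.trace_smul, smul_eq_mul, ← Matrix.transpose_mul,
      Matrix.trace_transpose, Matrix.trace_mul_comm, trace_compress]
  rw [h2, trace_compress]
  ring

end Enumerators

end

/-! ### Lower bound for codes: the linear program; the Hamming bound -/

section

/-! ### The linear programming bound -/

/-- Values of the quaternary Krawtchouk polynomials. -/
def krawtchouk (n j w : ℕ) : ℤ :=
  ∑ p ∈ Finset.HasAntidiagonal.antidiagonal j, ((n - w).choose p.1 * 3 ^ p.1) * (w.choose p.2 * (-1) ^ p.2)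

-- The generating polynomial of the signs by the weight of `E` factors over the qubits: a factor `1
-- + 3X` where `F` is trivial and `1 - X` where it is not. The Krawtchouk value is its coefficient
-- of degree `j`.
open Polynomial in
theorem sum_pauliSgn_wt {n : ℕ} (j : ℕ) (F : Fin n → Pauli) :
    ∑ E : Fin n → Pauli with wt E = j, pauliSgn E F = krawtchouk n j (wt F) := by
  have h1 : ∀ E : Fin n → Pauli,
      C (pauliSgn E F) * X ^ wt E = ∏ i, C ((E i).sgn (F i)) * (if E i = .I then 1 else X : ℤ[X]) := by
    intro E
    rw [Finset.prod_mul_distrib, pauliSgn, map_prod, wt, ← Finset.prod_const, Finset.prod_filter]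
    congr 1
    refine Finset.prod_congr rfl fun i _ => ?_
    by_cases h : E i = .I <;> simp [h]
  have h2 : ∑ E : Fin n → Pauli, C (pauliSgn E F) * X ^ wt E =
      ((1 + X : ℤ[X]) ^ (n - wt F)).comp (C 3 * X) * ((1 + X : ℤ[X]) ^ wt F).comp (C (-1) * X) := by
    simp only [h1]
    rw [← Fintype.piFinset_univ,
      ← Finset.prod_univ_sum (fun _ => Finset.univ)
        (fun i (p : Pauli) => C (p.sgn (F i)) * (if p = .I then 1 else X : ℤ[X]))]
    have h3 : ∀ i, ∑ p : Pauli, C (p.sgn (F i)) * (if p = .I then 1 else X : ℤ[X]) =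
        if F i ≠ .I then 1 + C (-1) * X else 1 + C 3 * X := by
      intro i
      rw [sum_pauli]
      cases F i <;> simp [Pauli.sgn]; ring
    simp only [h3]
    rw [Finset.prod_ite, Finset.prod_const, Finset.prod_const]
    have h4 : (Finset.univ.filter fun i => ¬ (F i ≠ .I)).card = n - wt F := by
      rw [wt, Finset.filter_not, Finset.card_sdiff_of_subset (Finset.filter_subset _ _)]
      simp
    rw [h4, mul_comm]
    simp [wt]
  have h3 := congrArg (fun p => p.coeff j) h2
  simp only [finsetSum_coeff, coeff_C_mul, coeff_X_pow] at h3
  simp only [coeff_mul, comp_C_mul_X_coeff,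
    coeff_one_add_X_pow] at h3
  rw [krawtchouk, Finset.sum_filter]
  rw [← h3]
  refine Finset.sum_congr rfl fun E _ => ?_
  by_cases h : wt E = j
  · simp [h]
  · simp [h, Ne.symm h]

variable {n : ℕ} {κ : Type} [Fintype κ]

theorem wt_le (F : Fin n → Pauli) : wt F ≤ n :=
  (Finset.card_le_univ _).trans (by simp)

/-- The Shor–Laflamme weight enumerator of a code. -/
def enumerator (V : Matrix (Qubits (Fin n)) κ ℂ) (w : ℕ) : ℝ :=
  ∑ F : Fin n → Pauli with wt F = w, (compress V F).trace.re ^ 2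

theorem enumerator_nonneg (V : Matrix (Qubits (Fin n)) κ ℂ) (w : ℕ) : 0 ≤ enumerator V w :=
  Finset.sum_nonneg fun _ _ => sq_nonneg _

/-- The sum of signs over `E` depends on `F` only through its weight. The function `f` is constant 1
for MacWilliams and `(-1) ^ w` for the shadow. -/
theorem sum_krawtchouk (V : Matrix (Qubits (Fin n)) κ ℂ) (f : ℕ → ℝ) (j : ℕ) :
    ∑ E : Fin n → Pauli with wt E = j, ∑ F : Fin n → Pauli,
        (pauliSgn E F : ℝ) * (f (wt F) * (compress V F).trace.re ^ 2) =
      ∑ w ∈ Finset.range (n + 1), (krawtchouk n j w : ℝ) * (f w * enumerator V w) := by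
  rw [Finset.sum_comm]
  have h1 : ∀ F : Fin n → Pauli, ∑ E : Fin n → Pauli with wt E = j,
        (pauliSgn E F : ℝ) * (f (wt F) * (compress V F).trace.re ^ 2) =
      (krawtchouk n j (wt F) : ℝ) * (f (wt F) * (compress V F).trace.re ^ 2) := by
    intro F
    rw [← Finset.sum_mul, ← sum_pauliSgn_wt]
    push_cast
    rfl
  simp only [h1]
  rw [← Finset.sum_fiberwise_of_maps_to (s := Finset.univ) (t := Finset.range (n + 1)) (g := wt)
    (fun F _ => Finset.mem_range.2 (Nat.lt_succ_of_le (wt_le F)))]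
  refine Finset.sum_congr rfl fun w _ => ?_
  rw [enumerator, Finset.mul_sum, Finset.mul_sum]
  refine Finset.sum_congr rfl fun F hF => ?_
  rw [(Finset.mem_filter.1 hF).2]

theorem macWilliams (V : Matrix (Qubits (Fin n)) κ ℂ) (E : Fin n → Pauli) :
    2 ^ n * (compress V E * compress V E).trace.re =
      ∑ F : Fin n → Pauli, (pauliSgn E F : ℝ) * (1 * (compress V F).trace.re ^ 2) := by
  have h := congrArg Complex.re (macWilliams_complex V E)
  have h2 : ∀ F : Fin n → Pauli, (pauliSgn E F : ℂ) * (compress V F).trace ^ 2 =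
      ((pauliSgn E F * (1 * (compress V F).trace.re ^ 2) : ℝ) : ℂ) := by
    intro F
    conv_lhs => rw [trace_compress_im]
    push_cast
    ring
  simp only [h2, ← Complex.ofReal_sum, Complex.ofReal_re, Fintype.card_fin] at h
  rw [← h, ← Complex.re_ofReal_mul]
  push_cast
  rfl

theorem shadow_nonneg (V : Matrix (Qubits (Fin n)) κ ℂ) (E : Fin n → Pauli) :
    0 ≤ ∑ F : Fin n → Pauli,
      (pauliSgn E F : ℝ) * ((-1) ^ wt F * (compress V F).trace.re ^ 2) := by
  obtain ⟨N, hN⟩ := shadow_complex V E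
  have h2 : ∀ F : Fin n → Pauli,
      (pauliSgn E F : ℂ) * (((-1 : ℤ) ^ wt F : ℂ) * (compress V F).trace ^ 2) =
      ((pauliSgn E F * ((-1) ^ wt F * (compress V F).trace.re ^ 2) : ℝ) : ℂ) := by
    intro F
    conv_lhs => rw [trace_compress_im]
    push_cast
    ring
  have h := congrArg Complex.re hN
  simp only [h2, ← Complex.ofReal_sum, Complex.ofReal_re, Fintype.card_fin] at h
  rw [h]
  have h3 : (2 : ℂ) ^ n * (N * Nᴴ).trace = ((2 ^ n * ∑ i, ∑ j, ‖N i j‖ ^ 2 : ℝ) : ℂ) := by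
    push_cast
    congr 1
    simp only [Matrix.trace, Matrix.diag, Matrix.mul_apply, Matrix.conjTranspose_apply]
    refine Finset.sum_congr rfl fun i _ => Finset.sum_congr rfl fun j _ => ?_
    rw [← Complex.mul_conj']
    rfl
  rw [h3, Complex.ofReal_re]
  positivity

/-- The quantum MacWilliams identity for the pure part of the enumerators. -/
theorem enumerator_of_scalar [DecidableEq κ] (hκ : Fintype.card κ = 2)
    (V : Matrix (Qubits (Fin n)) κ ℂ) (j : ℕ)
    (h : ∀ E : Fin n → Pauli, wt E = j → ∃ c : ℂ, compress V E = c • 1) :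
    2 ^ n * enumerator V j =
      2 * ∑ w ∈ Finset.range (n + 1), (krawtchouk n j w : ℝ) * (1 * enumerator V w) := by
  rw [← sum_krawtchouk V (fun _ => 1) j, enumerator, Finset.mul_sum, Finset.mul_sum]
  refine Finset.sum_congr rfl fun E hE => ?_
  rw [← macWilliams]
  obtain ⟨c, hc⟩ := h E (Finset.mem_filter.1 hE).2
  -- The scalar is real because the compression has real trace. In dimension 2 the square of its
  -- trace is then twice the trace of its square, whence the factor 2.
  have ht := trace_compress_im V E
  rw [hc, Matrix.trace_smul, Matrix.trace_one, hκ] at ht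
  have hc' : (c.im) = 0 := by
    have := congrArg Complex.im ht
    simpa using this
  rw [hc]
  simp [Matrix.trace_smul, hκ, hc', smul_smul]
  ring

theorem enumerator_zero [DecidableEq κ] (hκ : Fintype.card κ = 2)
    (V : Matrix (Qubits (Fin n)) κ ℂ) (hV : Vᴴ * V = 1) : enumerator V 0 = 4 := by
  have h : (Finset.univ.filter fun F : Fin n → Pauli => wt F = 0) = {fun _ => .I} := by
    ext F
    simp [wt, funext_iff, Finset.filter_eq_empty_iff]
  have h1 : pauliTens (fun _ : Fin n => Pauli.I) = 1 := tens_one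
  rw [enumerator, h, Finset.sum_singleton, compress, h1, Matrix.mul_one, hV, Matrix.trace_one, hκ]
  norm_num

theorem shadow_enumerator_nonneg (V : Matrix (Qubits (Fin n)) κ ℂ) (j : ℕ) :
    0 ≤ ∑ w ∈ Finset.range (n + 1), (krawtchouk n j w : ℝ) * ((-1) ^ w * enumerator V w) := by
  rw [← sum_krawtchouk V (fun w => (-1) ^ w) j]
  exact Finset.sum_nonneg fun E _ => shadow_nonneg V E

-- Once `n` is fixed this is a finite linear system. Nonnegativity in weights 1, 2, 3, 4, 7 and the
-- shadow inequalities 0, 2, 3, together with the five equations, suffice for every `n ≤ 10`.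
set_option maxHeartbeats 4000000 in
theorem linear_program_infeasible (n : ℕ) (hn : n ≤ 10) (A : ℕ → ℝ) (h0 : A 0 = 4)
    (hA : ∀ w, 0 ≤ A w)
    (hB : ∀ j ≤ 4, 2 ^ n * A j =
      2 * ∑ w ∈ Finset.range (n + 1), (krawtchouk n j w : ℝ) * (1 * A w))
    (hS : ∀ j, 0 ≤ ∑ w ∈ Finset.range (n + 1), (krawtchouk n j w : ℝ) * ((-1) ^ w * A w)) :
    False := by
  have hA1 := hA 1
  have hA2 := hA 2
  have hA3 := hA 3
  have hA4 := hA 4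
  have hA7 := hA 7
  have hB0 := hB 0 (by norm_num)
  have hB1 := hB 1 (by norm_num)
  have hB2 := hB 2 (by norm_num)
  have hB3 := hB 3 (by norm_num)
  have hB4 := hB 4 (by norm_num)
  have hS0 := hS 0
  have hS2 := hS 2
  have hS3 := hS 3
  clear hA hB hS
  interval_cases n <;>
    simp [Finset.sum_range_succ, krawtchouk, Finset.Nat.antidiagonal_succ, Nat.choose, h0]
      at hB0 hB1 hB2 hB3 hB4 hS0 hS2 hS3 <;>
    linarith

theorem le_of_existsQECC (n : ℕ) (h : ExistsQECC n 1 2) : 11 ≤ n := by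
  obtain ⟨V, r, R, hV, hR, hrec⟩ := h
  by_contra hn
  have hκ : Fintype.card (Qubits (Fin 1)) = 2 := by simp
  exact linear_program_infeasible n (by omega) (enumerator V) (enumerator_zero hκ V hV)
    (enumerator_nonneg V)
    (fun j hj => enumerator_of_scalar hκ V j fun E hE =>
      exists_compress_eq_smul_one V R hR hrec E (by omega))
    (shadow_enumerator_nonneg V)

theorem quantumHammingBound_iff (n : ℕ) : QuantumHammingBound n 1 2 ↔ 10 ≤ n := by
  constructor
  · intro h
    by_contra hn
    have hn : n ≤ 9 := by omega
    revert h
    unfold QuantumHammingBound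
    interval_cases n <;> decide
  · intro h
    -- The extra inequality holds from 10 on and makes the left side of the bound at most double
    -- when `n` grows by one.
    suffices 4 * n ≤ n.choose 2 ∧ 2 * (1 + 3 * n + 9 * n.choose 2) ≤ 2 ^ n by
      simpa [QuantumHammingBound, Finset.sum_range_succ] using this.2
    induction n, h using Nat.le_induction with
    | base => decide
    | succ m hm ih =>
      rw [Nat.choose_succ_succ' m 1, Nat.choose_one_right, pow_succ]
      change 4 * m ≤ m.choose 2 ∧ _ at ih
      change _ ≤ m + m.choose 2 ∧ 2 * (1 + 3 * (m + 1) + 9 * (m + m.choose 2)) ≤ _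
      omega

end

/-! ### Purification: block operators and states as coefficient matrices -/

section

/-! ### The algebra of local operators -/

variable {n : ℕ}

/-- Splitting the labels into those on `T` and those off `T` exhibits a Kronecker product, so that
products, adjoints and traces can be read off from those of Kronecker products. -/
theorem localOp_eq_submatrix (T : Finset (Fin n)) (A : Matrix (Qubits T) (Qubits T) ℂ) :
    localOp T A = (A ⊗ₖ (1 : Matrix (Qubits {i // i ∉ T}) (Qubits {i // i ∉ T}) ℂ)).submatrix
      (Equiv.piEquivPiSubtypeProd (· ∈ T) fun _ => Fin 2)
      (Equiv.piEquivPiSubtypeProd (· ∈ T) fun _ => Fin 2) := by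
  ext x y
  simp only [localOp, Matrix.submatrix_apply, Matrix.kroneckerMap_apply, Matrix.one_apply,
    Equiv.piEquivPiSubtypeProd_apply, funext_iff, Subtype.forall, mul_ite, mul_one, mul_zero]

theorem localOp_mul (T : Finset (Fin n)) (A B : Matrix (Qubits T) (Qubits T) ℂ) :
    localOp T (A * B) = localOp T A * localOp T B := by
  simp only [localOp_eq_submatrix, Matrix.submatrix_mul_equiv, ← Matrix.mul_kronecker_mul,
    Matrix.mul_one]

theorem localOp_one (T : Finset (Fin n)) : localOp T 1 = 1 := by
  simp only [localOp_eq_submatrix, Matrix.one_kronecker_one, Matrix.submatrix_one_equiv]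

theorem localOp_conjTranspose (T : Finset (Fin n)) (A : Matrix (Qubits T) (Qubits T) ℂ) :
    localOp T Aᴴ = (localOp T A)ᴴ := by
  simp only [localOp_eq_submatrix, Matrix.conjTranspose_submatrix, Matrix.conjTranspose_kronecker,
    Matrix.conjTranspose_one]

theorem localOp_transpose (T : Finset (Fin n)) (A : Matrix (Qubits T) (Qubits T) ℂ) :
    localOp T Aᵀ = (localOp T A)ᵀ := by
  ext x y
  simp only [localOp, Matrix.transpose_apply, eq_comm]

theorem localOp_trace (T : Finset (Fin n)) (A : Matrix (Qubits T) (Qubits T) ℂ) :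
    (localOp T A).trace = A.trace * 2 ^ (n - T.card) := by
  have h := Matrix.trace_kronecker A (1 : Matrix (Qubits {i // i ∉ T}) (Qubits {i // i ∉ T}) ℂ)
  rw [Matrix.trace_one] at h
  rw [localOp_eq_submatrix, Matrix.trace]
  refine (Equiv.sum_comp (Equiv.piEquivPiSubtypeProd (· ∈ T) fun _ => Fin 2)
    (fun p => (A ⊗ₖ (1 : Matrix (Qubits {i // i ∉ T}) (Qubits {i // i ∉ T}) ℂ)) p p)).trans
    (h.trans ?_)
  simp

theorem localOp_injective (T : Finset (Fin n)) : Function.Injective (localOp T) := by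
  intro A B h
  ext x y
  have := congrFun (congrFun h (fun i => if h : i ∈ T then x ⟨i, h⟩ else 0))
    (fun i => if h : i ∈ T then y ⟨i, h⟩ else 0)
  simpa +contextual [localOp] using this

/-- The algebra of operators that act on the qubits in `T` only. -/
def localAlg (T : Finset (Fin n)) :
    Subalgebra ℂ (Matrix (Qubits (Fin n)) (Qubits (Fin n)) ℂ) where
  carrier := Set.range (localOp T)
  mul_mem' := by
    rintro _ _ ⟨A, rfl⟩ ⟨B, rfl⟩
    exact ⟨A * B, localOp_mul T A B⟩
  add_mem' := by
    rintro _ _ ⟨A, rfl⟩ ⟨B, rfl⟩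
    exact ⟨A + B, localOp_add T A B⟩
  algebraMap_mem' c := ⟨c • 1, by rw [localOp_smul, localOp_one, Algebra.algebraMap_eq_smul_one]⟩

theorem localOp_mem_localAlg (T : Finset (Fin n)) (A : Matrix (Qubits T) (Qubits T) ℂ) :
    localOp T A ∈ localAlg T := ⟨A, rfl⟩

theorem pauliOp_mem_localAlg {T : Finset (Fin n)} {F : Fin n → Pauli}
    (hF : ∀ i, i ∉ T → F i = .I) : pauliOp F ∈ localAlg T := by
  rw [exists_localOp_eq_pauliOp T F hF]
  exact localOp_mem_localAlg _ _

theorem pauliProj_mem_localAlg {T : Finset (Fin n)} {F : Fin n → Pauli}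
    (hF : ∀ i, i ∉ T → F i = .I) (a : Bool) : pauliProj F a ∈ localAlg T :=
  Subalgebra.smul_mem _ (add_mem (one_mem _)
    (Subalgebra.smul_mem _ (pauliOp_mem_localAlg hF) _)) _

theorem localAlg_mono {T T' : Finset (Fin n)} (h : T ⊆ T') : localAlg T ≤ localAlg T' := by
  rintro _ ⟨A, rfl⟩
  exact localOp_mem T (Subalgebra.toSubmodule (localAlg T'))
    (fun F hF => pauliOp_mem_localAlg fun i hi => hF i fun hi' => hi (h hi')) A

theorem pauliOp_mul_comm (P Q : Fin n → Pauli) :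
    pauliOp P * pauliOp Q = (pauliSgn P Q : ℂ) • (pauliOp Q * pauliOp P) :=
  pauliTens_mul_comm P Q

theorem pauliOp_sq (P : Fin n → Pauli) : pauliOp P * pauliOp P = 1 := pauliTens_sq P

theorem pauliOp_conjTranspose (P : Fin n → Pauli) : (pauliOp P)ᴴ = pauliOp P :=
  pauliTens_conjTranspose P

theorem pauliOp_commute {P Q : Fin n → Pauli} (h : pauliSgn P Q = 1) :
    Commute (pauliOp P) (pauliOp Q) := by
  have := pauliOp_mul_comm P Q
  rwa [h, Int.cast_one, one_smul] at this

/-- Centralizers are linear subspaces, so `localOp_mem`, applied once in each argument, reduces the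
claim to Pauli operators with disjoint supports. -/
theorem localAlg_commute {T T' : Finset (Fin n)} (h : Disjoint T T')
    {A B : Matrix (Qubits (Fin n)) (Qubits (Fin n)) ℂ} (hA : A ∈ localAlg T)
    (hB : B ∈ localAlg T') : Commute A B := by
  obtain ⟨A, rfl⟩ := hA
  obtain ⟨B, rfl⟩ := hB
  have key : ∀ F : Fin n → Pauli, (∀ i, i ∉ T → F i = .I) →
      Commute (pauliOp F) (localOp T' B) := by
    intro F hF
    refine (Subalgebra.mem_centralizer_iff ℂ).1 (localOp_mem T'
      (Subalgebra.toSubmodule (Subalgebra.centralizer ℂ {pauliOp F})) ?_ B) _ rfl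
    intro G hG
    refine (Subalgebra.mem_centralizer_iff ℂ).2 ?_
    rintro _ rfl
    refine pauliOp_commute (Finset.prod_eq_one fun i _ => ?_)
    by_cases hi : i ∈ T
    · rw [hG i (Finset.disjoint_left.1 h hi)]
      cases F i <;> rfl
    · rw [hF i hi]
      rfl
  refine ((Subalgebra.mem_centralizer_iff ℂ).1 (localOp_mem T
      (Subalgebra.toSubmodule (Subalgebra.centralizer ℂ {localOp T' B})) ?_ A) _ rfl).symm
  intro F hF
  refine (Subalgebra.mem_centralizer_iff ℂ).2 ?_
  rintro _ rfl
  exact (key F hF).symm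

/-! ### Bipartite pure states as matrices -/

/-- The unnormalized pure state with coefficient matrix `M`. -/
def pureState {α : Type} (M : Matrix α α ℂ) : Matrix (α × α) (α × α) ℂ :=
  fun p q => M p.1 p.2 * star (M q.1 q.2)

/-- Alice's operators become left factors and Bob's become transposed right factors, which turns the
whole protocol into matrix products. -/
theorem conj_pureState {α : Type} [Fintype α] (A B M : Matrix α α ℂ) :
    (A ⊗ₖ B) * pureState M * (A ⊗ₖ B)ᴴ = pureState (A * M * Bᵀ) := by
  have h1 : ∀ M : Matrix α α ℂ,
      pureState M = Matrix.vecMulVec (fun p => M p.1 p.2) (star fun p => M p.1 p.2) := by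
    intro M; ext p q; simp [pureState, Matrix.vecMulVec_apply]
  have h2 : (A ⊗ₖ B).mulVec (fun p => M p.1 p.2) = fun p => (A * M * Bᵀ) p.1 p.2 := by
    ext ⟨x, y⟩
    simp only [Matrix.mulVec, dotProduct, Fintype.sum_prod_type, Matrix.kroneckerMap_apply,
      Matrix.mul_apply, Matrix.transpose_apply, Finset.sum_mul]
    rw [Finset.sum_comm]
    exact Finset.sum_congr rfl fun _ _ => Finset.sum_congr rfl fun _ _ => by ring
  rw [h1, h1, Matrix.mul_vecMulVec, Matrix.vecMulVec_mul, h2, ← h2, Matrix.star_mulVec]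

theorem eprState_eq (ι : Type) [Fintype ι] [DecidableEq ι] :
    eprState ι = pureState ((((1 / √2 : ℝ) : ℂ) ^ Fintype.card ι) • 1) := by
  ext p q
  have h : ∀ p : Pairs ι, ∏ i, eprPair (p.1 i, p.2 i) =
      ((((1 / √2 : ℝ) : ℂ) ^ Fintype.card ι) • (1 : Matrix (Qubits ι) (Qubits ι) ℂ)) p.1 p.2 := by
    intro p
    simp only [eprPair, Finset.prod_ite_zero, Matrix.smul_apply, Matrix.one_apply, funext_iff,
      Finset.prod_const, Finset.card_univ, Finset.mem_univ, forall_true_left, smul_eq_mul, mul_ite,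
      mul_one, mul_zero]
  simp only [eprState, pureState, h]

/-- A local operator on the complement of `K` leaves perfect pairs in `K`. -/
theorem reducedState_pureState {K : Finset (Fin n)}
    {N : Matrix (Qubits (Fin n)) (Qubits (Fin n)) ℂ} (hN : N ∈ localAlg Kᶜ) :
    reducedState K (pureState N) = (pureState N).trace • eprState K := by
  obtain ⟨S, rfl⟩ := hN
  set N' : Matrix (Qubits {i // i ∉ K}) (Qubits {i // i ∉ K}) ℂ := fun c d =>
    S (fun i => c ⟨i, Finset.mem_compl.1 i.2⟩) (fun i => d ⟨i, Finset.mem_compl.1 i.2⟩)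
  -- The coefficient matrix is `1` on `K` tensored with `N'` elsewhere: the state is a product of
  -- unnormalized perfect pairs on `K` and some state of the other pairs.
  have hg : ∀ x c y d, localOp Kᶜ S (glue K x c) (glue K y d) =
      if x = y then N' c d else 0 := by
    intro x c y d
    have h1 : (∀ i, i ∉ Kᶜ → glue K x c i = glue K y d i) ↔ x = y := by
      simp +contextual [glue, funext_iff]
    have h2 : ∀ (x : Qubits K) (c : Qubits {i // i ∉ K}),
        (fun i : {i // i ∈ Kᶜ} => glue K x c i) =
          fun i : {i // i ∈ Kᶜ} => c ⟨i, Finset.mem_compl.1 i.2⟩ := by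
      intro x c
      funext i
      simp [glue, Finset.mem_compl.1 i.2]
    simp only [localOp, h1, h2, N']
  have he : ∀ x c, glue K x c = (Equiv.piEquivPiSubtypeProd (· ∈ K) fun _ => Fin 2).symm (x, c) := by
    intro x c
    funext i
    simp [glue, Equiv.piEquivPiSubtypeProd]
  set s : ℂ := ∑ c : Pairs {i // i ∉ K}, N' c.1 c.2 * star (N' c.1 c.2)
  have htr : (pureState (localOp Kᶜ S)).trace = 2 ^ K.card * s := by
    simp only [Matrix.trace, Matrix.diag, pureState]
    have := Fintype.sum_equiv
      ((Equiv.piEquivPiSubtypeProd (· ∈ K) fun _ => Fin 2).symm.prodCongr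
        (Equiv.piEquivPiSubtypeProd (· ∈ K) fun _ => Fin 2).symm)
      (fun p => (if p.1.1 = p.2.1 then N' p.1.2 p.2.2 else 0) *
        star (if p.1.1 = p.2.1 then N' p.1.2 p.2.2 else 0))
      (fun p => localOp Kᶜ S p.1 p.2 * star (localOp Kᶜ S p.1 p.2)) (by
        rintro ⟨⟨x, c⟩, y, d⟩
        simp only [Equiv.prodCongr_apply, Prod.map_apply, ← he, hg])
    rw [← this]
    simp only [Fintype.sum_prod_type, s]
    have h3 : ∀ (x : Qubits K) (c : Qubits {i // i ∉ K}), ∑ y : Qubits K, ∑ d,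
        ((if x = y then N' c d else 0) * star (if x = y then N' c d else 0)) =
          ∑ d, N' c d * star (N' c d) := by
      intro x c
      rw [Finset.sum_eq_single x]
      · simp
      · intro y _ hy
        simp [Ne.symm hy]
      · simp
    simp only [h3, Finset.sum_const, Finset.card_univ, nsmul_eq_mul]
    simp
  rw [htr, eprState_eq]
  ext p q
  simp only [reducedState, pureState, hg, Matrix.smul_apply, smul_eq_mul, Matrix.one_apply]
  -- The normalization of the perfect pairs cancels the factor `2 ^ K.card` in the trace.
  have h2 : ((1 / √2 : ℝ) : ℂ) ^ K.card * star (((1 / √2 : ℝ) : ℂ) ^ K.card) * 2 ^ K.card = 1 := by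
    have : ((1 / √2 : ℝ) : ℂ) * star ((1 / √2 : ℝ) : ℂ) * 2 = 1 := by
      have : (1 / √2 : ℝ) * (1 / √2) * 2 = 1 := by
        field_simp; norm_num
      simp only [Complex.star_def, Complex.conj_ofReal]
      exact_mod_cast this
    rw [star_pow, ← mul_pow, ← mul_pow, this, one_pow]
  by_cases hp : p.1 = p.2 <;> by_cases hq : q.1 = q.2 <;> simp [hp, hq]
  simp only [one_div, Complex.ofReal_inv, inv_pow, Complex.star_def, map_inv₀, map_pow,
    Complex.conj_ofReal] at h2
  change s = _
  linear_combination (-s) * h2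

/-- A mixture of pure states. -/
def mixedState {α : Type} {m : ℕ} (M : Fin m → Matrix α α ℂ) : Matrix (α × α) (α × α) ℂ :=
  ∑ i, pureState (M i)

theorem conj_mixedState {α : Type} [Fintype α] {m : ℕ} (A B : Matrix α α ℂ)
    (M : Fin m → Matrix α α ℂ) :
    (A ⊗ₖ B) * mixedState M * (A ⊗ₖ B)ᴴ = mixedState fun i => A * M i * Bᵀ := by
  simp only [mixedState, Matrix.mul_sum, Matrix.sum_mul, conj_pureState]

theorem trace_conj_unitary {α : Type} [Fintype α] [DecidableEq α]
    (A B : Matrix.unitaryGroup α ℂ) (ρ : Matrix (α × α) (α × α) ℂ) :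
    ((A.1 ⊗ₖ B.1) * ρ * (A.1 ⊗ₖ B.1)ᴴ).trace = ρ.trace := by
  have hA : (A.1)ᴴ * A.1 = 1 := Matrix.mem_unitaryGroup_iff'.1 A.2
  have hB : (B.1)ᴴ * B.1 = 1 := Matrix.mem_unitaryGroup_iff'.1 B.2
  rw [Matrix.trace_mul_comm, ← Matrix.mul_assoc, Matrix.conjTranspose_kronecker,
    ← Matrix.mul_kronecker_mul, hA, hB, Matrix.one_kronecker_one, Matrix.one_mul]

theorem reducedState_sum {m : ℕ} (K : Finset (Fin n))
    (ρ : Fin m → Matrix (Pairs (Fin n)) (Pairs (Fin n)) ℂ) :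
    reducedState K (∑ i, ρ i) = ∑ i, reducedState K (ρ i) := by
  ext p q
  simp only [reducedState, Matrix.sum_apply]
  exact Finset.sum_comm

/-- Each pure component is treated separately by `reducedState_pureState`. The resulting criterion
is linear in `M i`, which later allows a reduction to Pauli errors. -/
theorem succeeds_extract {k m : ℕ} (e : Extraction n)
    (M : Fin m → Matrix (Qubits (Fin n)) (Qubits (Fin n)) ℂ) (hk : k ≤ e.keep.card)
    (h : ∀ i, e.UA.1 * M i * (e.UB.1)ᵀ ∈ localAlg (e.keep)ᶜ) :
    (TwoEPP.extract e).Succeeds k (mixedState M) := by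
  refine ⟨hk, ?_⟩
  rw [← trace_conj_unitary e.UA e.UB, conj_mixedState, mixedState, reducedState_sum,
    Matrix.trace_sum, Finset.sum_smul]
  exact Finset.sum_congr rfl fun i _ => reducedState_pureState (h i)

/-- Since the coefficient matrix of perfect pairs is a multiple of `1`, each Kraus operator
contributes one pure state, whose matrix is the transposed operator. -/
theorem applyKraus_eprState {m : ℕ} (T : Finset (Fin n))
    (S : Fin m → Matrix (Qubits T) (Qubits T) ℂ) :
    applyKraus (fun i => (1 : Matrix (Qubits (Fin n)) (Qubits (Fin n)) ℂ) ⊗ₖ localOp T (S i))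
      (eprState (Fin n)) =
    mixedState fun i => localOp T ((((1 / √2 : ℝ) : ℂ) ^ n) • (S i)ᵀ) := by
  simp only [applyKraus, eprState_eq, conj_pureState, mixedState, localOp_smul, localOp_transpose,
    Matrix.one_mul, Matrix.smul_mul, Fintype.card_fin]

/-! ### Joint measurements -/

/-- The projector onto the joint eigenspace of the listed operators for the given outcomes. -/
def jointProj : List (Fin n → Pauli) → List Bool → Matrix (Qubits (Fin n)) (Qubits (Fin n)) ℂ
  -- The head of the list is measured first and so stands rightmost.
  | M :: L, a :: s => jointProj L s * pauliProj M a
  | _, _ => 1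

theorem succeeds_measureAll {k m : ℕ} (L : List (Fin n → Pauli))
    (next : List (Bool × Bool) → TwoEPP n)
    (M : Fin m → Matrix (Qubits (Fin n)) (Qubits (Fin n)) ℂ)
    (h : ∀ r : List (Bool × Bool), r.length = L.length → (next r).Succeeds k
      (mixedState fun i => jointProj L (r.map Prod.fst) * M i *
        (jointProj L (r.map Prod.snd))ᵀ)) :
    (TwoEPP.measureAll L next).Succeeds k (mixedState M) := by
  induction L generalizing next M with
  | nil => simpa [jointProj, TwoEPP.measureAll] using h [] rfl
  | cons P L ih =>
    intro a b
    rw [conj_mixedState]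
    refine ih _ _ fun r hr => ?_
    have := h ((a, b) :: r) (by simp [hr])
    simpa [jointProj, Matrix.transpose_mul, Matrix.mul_assoc] using this

end

/-! ### Purification: stabilizer projectors and their decoding -/

section

variable {n : ℕ}

/-! ### Stabilizer projectors -/

theorem pauliProj_mul_self (M : Fin n → Pauli) (a b : Bool) :
    pauliProj M a * pauliProj M b = if a = b then pauliProj M a else 0 := by
  have h := pauliOp_sq M
  cases a <;> cases b <;>
    simp [pauliProj, mul_add, add_mul, smul_smul, h] <;> module

/-- An error preserves the two eigenspaces of `M` if it commutes with `M` and exchanges them if it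
anticommutes. -/
theorem pauliProj_mul_pauliOp (M E : Fin n → Pauli) (a : Bool) :
    pauliProj M a * pauliOp E = pauliOp E * pauliProj M (a ^^ decide (pauliSgn M E = -1)) := by
  have h := pauliOp_mul_comm M E
  rcases pauliSgn_eq M E with hs | hs <;> rw [hs] at h <;> cases a <;>
    simp [pauliProj, mul_add, add_mul, h, hs]

theorem pauliProj_conjTranspose (M : Fin n → Pauli) (a : Bool) :
    (pauliProj M a)ᴴ = pauliProj M a := by
  cases a <;> simp [pauliProj, Matrix.conjTranspose_smul, pauliOp_conjTranspose]

/-- The outcomes that the error `E` flips. -/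
def syndrome (L : List (Fin n → Pauli)) (E : Fin n → Pauli) : List Bool :=
  L.map fun M => decide (pauliSgn M E = -1)

/-- A list of commuting, real Pauli operators. -/
def IsRealCommuting (L : List (Fin n → Pauli)) : Prop :=
  (∀ P ∈ L, ∀ Q ∈ L, pauliSgn P Q = 1) ∧ ∀ P ∈ L, (pauliOp P)ᵀ = pauliOp P

theorem IsRealCommuting.tail {M : Fin n → Pauli} {L : List (Fin n → Pauli)}
    (h : IsRealCommuting (M :: L)) : IsRealCommuting L :=
  ⟨fun P hP Q hQ => h.1 P (List.mem_cons_of_mem _ hP) Q (List.mem_cons_of_mem _ hQ),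
    fun P hP => h.2 P (List.mem_cons_of_mem _ hP)⟩

theorem commute_pauliProj {A : Matrix (Qubits (Fin n)) (Qubits (Fin n)) ℂ} {M : Fin n → Pauli}
    (h : Commute A (pauliOp M)) (a : Bool) : Commute A (pauliProj M a) :=
  ((Commute.one_right A).add_right (h.smul_right _)).smul_right _

theorem commute_jointProj {A : Matrix (Qubits (Fin n)) (Qubits (Fin n)) ℂ}
    {L : List (Fin n → Pauli)} (h : ∀ M ∈ L, Commute A (pauliOp M)) (s : List Bool) :
    Commute A (jointProj L s) := by
  induction L generalizing s with
  | nil => exact Commute.one_right A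
  | cons M L ih =>
    cases s with
    | nil => exact Commute.one_right A
    | cons a s =>
      exact (ih (fun P hP => h P (List.mem_cons_of_mem _ hP)) s).mul_right
        (commute_pauliProj (h M List.mem_cons_self) a)

theorem IsRealCommuting.commute_head {M : Fin n → Pauli} {L : List (Fin n → Pauli)}
    (h : IsRealCommuting (M :: L)) (a : Bool) (s : List Bool) :
    Commute (pauliProj M a) (jointProj L s) :=
  commute_jointProj (fun P hP => (commute_pauliProj (pauliOp_commute
    (h.1 P (List.mem_cons_of_mem _ hP) M List.mem_cons_self)) a).symm) s

theorem jointProj_mul_self {L : List (Fin n → Pauli)} (hL : IsRealCommuting L) {a b : List Bool}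
    (ha : a.length = L.length) (hb : b.length = L.length) :
    jointProj L a * jointProj L b = if a = b then jointProj L a else 0 := by
  induction L generalizing a b with
  | nil => simp_all [jointProj]
  | cons M L ih =>
    cases a with
    | nil => simp at ha
    | cons x a =>
      cases b with
      | nil => simp at hb
      | cons y b =>
        simp only [List.length_cons, Nat.add_right_cancel_iff] at ha hb
        have hc := (hL.commute_head x b).eq
        calc jointProj L a * pauliProj M x * (jointProj L b * pauliProj M y)
            = jointProj L a * jointProj L b * (pauliProj M x * pauliProj M y) := by
              rw [mul_assoc, ← mul_assoc (pauliProj M x), hc]; simp only [mul_assoc]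
          _ = _ := by
              rw [ih hL.tail ha hb, pauliProj_mul_self]
              by_cases h1 : a = b <;> by_cases h2 : x = y <;> simp [h1, h2, jointProj]

theorem jointProj_mul_pauliOp (L : List (Fin n → Pauli)) (E : Fin n → Pauli) {a : List Bool}
    (ha : a.length = L.length) :
    jointProj L a * pauliOp E =
      pauliOp E * jointProj L (List.zipWith (· ^^ ·) a (syndrome L E)) := by
  induction L generalizing a with
  | nil => cases a <;> simp [jointProj]
  | cons M L ih =>
    cases a with
    | nil => simp at ha
    | cons x a =>
      simp only [List.length_cons, Nat.add_right_cancel_iff] at ha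
      simp only [jointProj, syndrome, List.map_cons, List.zipWith_cons_cons]
      rw [mul_assoc, pauliProj_mul_pauliOp, ← mul_assoc, ih ha, mul_assoc]
      rfl

theorem jointProj_transpose {L : List (Fin n → Pauli)} (hL : IsRealCommuting L) (a : List Bool) :
    (jointProj L a)ᵀ = jointProj L a := by
  induction L generalizing a with
  | nil => simp [jointProj]
  | cons M L ih =>
    cases a with
    | nil => simp [jointProj]
    | cons x a =>
      have : (pauliProj M x)ᵀ = pauliProj M x := by
        cases x <;> simp [pauliProj, Matrix.transpose_smul, hL.2 M List.mem_cons_self]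
      rw [jointProj, Matrix.transpose_mul, ih hL.tail, this]
      exact (hL.commute_head x a).eq

theorem jointProj_conjTranspose {L : List (Fin n → Pauli)} (hL : IsRealCommuting L)
    (a : List Bool) : (jointProj L a)ᴴ = jointProj L a := by
  induction L generalizing a with
  | nil => simp [jointProj]
  | cons M L ih =>
    cases a with
    | nil => simp [jointProj]
    | cons x a =>
      rw [jointProj, Matrix.conjTranspose_mul, ih hL.tail, pauliProj_conjTranspose]
      exact (hL.commute_head x a).eq

theorem jointProj_mem_localAlg {T : Finset (Fin n)} {L : List (Fin n → Pauli)}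
    (h : ∀ M ∈ L, ∀ i, i ∉ T → M i = .I) (a : List Bool) : jointProj L a ∈ localAlg T := by
  induction L generalizing a with
  | nil => exact one_mem _
  | cons M L ih =>
    cases a with
    | nil => exact one_mem _
    | cons x a =>
      exact mul_mem (ih (fun P hP => h P (List.mem_cons_of_mem _ hP)) a)
        (pauliProj_mem_localAlg (h M List.mem_cons_self) x)

/-- Each operator of the list anticommutes with a Pauli operator that commutes with all
later ones. -/
def HasDestabilizers : List (Fin n → Pauli) → Prop
  | [] => True
  | M :: L => (∃ D, pauliSgn M D = -1 ∧ ∀ P ∈ L, pauliSgn P D = 1) ∧ HasDestabilizers L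

/-- Each generator halves the trace. Conjugation by its destabilizer `D` fixes the projector `Q` of
the later generators and negates `M`, so `Q * M` has trace zero. -/
theorem jointProj_trace {L : List (Fin n → Pauli)} (hL : HasDestabilizers L) {a : List Bool}
    (ha : a.length = L.length) : (jointProj L a).trace * 2 ^ L.length = 2 ^ n := by
  induction L generalizing a with
  | nil => simp [jointProj]
  | cons M L ih =>
    cases a with
    | nil => simp at ha
    | cons x a =>
      simp only [List.length_cons, Nat.add_right_cancel_iff] at ha
      obtain ⟨⟨D, hM, hD⟩, hL⟩ := hL
      have hc : Commute (pauliOp D) (jointProj L a) :=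
        commute_jointProj (fun P hP => (pauliOp_commute (hD P hP)).symm) a
      have h0 : (jointProj L a * pauliOp M).trace = 0 := by
        have h1 : jointProj L a * pauliOp M =
            -(pauliOp D * (jointProj L a * pauliOp M) * pauliOp D) := by
          have h2 := pauliOp_mul_comm M D
          rw [hM] at h2
          rw [← mul_assoc, hc.eq, mul_assoc, mul_assoc, h2]
          simp [← mul_assoc, pauliOp_sq]
        have h3 := congrArg Matrix.trace h1
        rw [Matrix.trace_neg, Matrix.trace_mul_comm (pauliOp D * _), ← mul_assoc, pauliOp_sq,
          one_mul] at h3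
        exact self_eq_neg.1 h3
      have h1 : (jointProj (M :: L) (x :: a)).trace = (jointProj L a).trace / 2 := by
        simp only [jointProj, pauliProj, mul_smul_comm, mul_add, mul_one, Matrix.trace_smul,
          Matrix.trace_add, h0, smul_eq_mul, mul_zero, add_zero]
        ring
      rw [h1, List.length_cons, pow_succ, ← ih hL ha]
      ring

/-! ### Decoding unitaries -/

/-- A projector has eigenvalues 0 and 1, and its trace counts the ones. Diagonalizing and then
permuting the eigenvectors moves the ones onto `s`. -/
theorem exists_unitary_conj_eq_diagonal {α : Type} [Fintype α] [DecidableEq α]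
    {q : Matrix α α ℂ} (hq : qᴴ = q) (hqq : q * q = q) (s : Finset α) (hs : q.trace = s.card) :
    ∃ U ∈ Matrix.unitaryGroup α ℂ, U * q * Uᴴ = Matrix.diagonal fun i => if i ∈ s then 1 else 0 := by
  have hH : q.IsHermitian := hq
  set W := hH.eigenvectorUnitary.1 with hW
  have hWW : Wᴴ * W = 1 := Matrix.mem_unitaryGroup_iff'.1 hH.eigenvectorUnitary.2
  have hWW' : W * Wᴴ = 1 := Matrix.mem_unitaryGroup_iff.1 hH.eigenvectorUnitary.2
  have hd : Wᴴ * q * W = Matrix.diagonal (fun i => (hH.eigenvalues i : ℂ)) := by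
    have := hH.conjStarAlgAut_star_eigenvectorUnitary
    rw [Unitary.conjStarAlgAut_star_apply] at this
    exact this
  have hev : ∀ i, hH.eigenvalues i = 0 ∨ hH.eigenvalues i = 1 := by
    intro i
    have h1 : (Wᴴ * q * W) * (Wᴴ * q * W) = Wᴴ * q * W := by
      calc _ = Wᴴ * q * (W * Wᴴ) * q * W := by simp only [Matrix.mul_assoc]
        _ = _ := by rw [hWW', Matrix.mul_one, Matrix.mul_assoc Wᴴ, hqq]
    rw [hd, Matrix.diagonal_mul_diagonal] at h1
    have h2 := congrFun (Matrix.diagonal_injective h1) i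
    have h3 : hH.eigenvalues i * hH.eigenvalues i = hH.eigenvalues i := by exact_mod_cast h2
    rcases mul_eq_zero.1 (by linear_combination h3 :
      hH.eigenvalues i * (hH.eigenvalues i - 1) = 0) with h | h
    · exact Or.inl h
    · exact Or.inr (by linarith)
  set t : Finset α := Finset.univ.filter fun i => hH.eigenvalues i = 1 with ht
  have hev' : ∀ i, (hH.eigenvalues i : ℂ) = if i ∈ t then 1 else 0 := by
    intro i
    rcases hev i with h | h <;> simp [ht, h]
  have htr : q.trace = t.card := by
    have h1 : q.trace = (Wᴴ * q * W).trace := by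
      rw [Matrix.mul_assoc, Matrix.trace_mul_comm, Matrix.mul_assoc, hWW', Matrix.mul_one]
    rw [h1, hd, Matrix.trace_diagonal]
    simp [hev']
  have hcard : t.card = s.card := by
    rw [hs] at htr
    exact_mod_cast htr.symm
  obtain ⟨σ, hσ⟩ : ∃ σ : Equiv.Perm α, ∀ i, σ i ∈ t ↔ i ∈ s := by
    have e : {i // i ∈ s} ≃ {i // i ∈ t} := Fintype.equivOfCardEq (by simp [hcard])
    refine ⟨e.extendSubtype, fun i => ?_⟩
    by_cases hi : i ∈ s
    · simpa [hi] using e.extendSubtype_mem i hi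
    · simpa [hi] using e.extendSubtype_not_mem i hi
  refine ⟨Wᴴ.submatrix σ id, ?_, ?_⟩
  · rw [Matrix.mem_unitaryGroup_iff]
    change Wᴴ.submatrix σ id * (Wᴴ.submatrix σ id)ᴴ = 1
    rw [Matrix.conjTranspose_submatrix, Matrix.conjTranspose_conjTranspose,
      ← Matrix.submatrix_mul _ _ _ _ _ Function.bijective_id, hWW, Matrix.submatrix_one_equiv]
  · have h1 : Wᴴ.submatrix σ id * q * (Wᴴ.submatrix σ id)ᴴ = (Wᴴ * q * W).submatrix σ σ := by
      rw [Matrix.conjTranspose_submatrix, Matrix.conjTranspose_conjTranspose,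
        Matrix.submatrix_mul _ _ _ id _ Function.bijective_id,
        Matrix.submatrix_mul _ _ _ id _ Function.bijective_id, Matrix.submatrix_id_id]
    rw [h1, hd, Matrix.submatrix_diagonal_equiv]
    congr 1
    funext i
    simp [hev', hσ]

/-- A stabilizer projector in the block `B` can be decoded into the qubits in `K`. -/
theorem exists_decoder {B K : Finset (Fin n)} (hKB : K ⊆ B)
    {Q : Matrix (Qubits (Fin n)) (Qubits (Fin n)) ℂ} (hQ : Q ∈ localAlg B) (hQH : Qᴴ = Q)
    (hQQ : Q * Q = Q) (htr : Q.trace = 2 ^ (n - B.card) * 2 ^ K.card) :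
    ∃ U ∈ Matrix.unitaryGroup (Qubits (Fin n)) ℂ, (∃ S, U = localOp B S) ∧
      U * Q * Uᴴ ∈ localAlg Kᶜ := by
  obtain ⟨q, rfl⟩ := hQ
  rw [← localOp_conjTranspose] at hQH
  rw [← localOp_mul] at hQQ
  -- The target projector fixes the block's qubits outside `K` to `0` and leaves those in `K` free.
  -- It has the required rank `2 ^ K.card` and acts trivially on `K`.
  set s : Finset (Qubits B) := Finset.univ.filter fun x => ∀ i, i.1 ∉ K → x i = 0 with hs
  have hcard : s.card = 2 ^ K.card := by
    have h1 : s.card = (Finset.univ : Finset (Qubits K)).card := by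
      refine Finset.card_bij' (fun x _ (i : K) => x ⟨i, hKB i.2⟩)
        (fun y _ (i : B) => if h : i.1 ∈ K then y ⟨i, h⟩ else 0) ?_ ?_ ?_ ?_
      · simp
      · simp +contextual [hs]
      · intro x hx
        funext i
        simp only [hs, Finset.mem_filter, Finset.mem_univ, true_and] at hx
        by_cases h : i.1 ∈ K <;> simp [h, hx]
      · intro y _
        funext i
        simp
    rw [h1]
    simp
  have hqt : q.trace = s.card := by
    rw [localOp_trace, mul_comm] at htr
    rw [hcard, mul_left_cancel₀ (pow_ne_zero _ two_ne_zero) htr]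
    push_cast
    rfl
  obtain ⟨U, hU, hUq⟩ := exists_unitary_conj_eq_diagonal (localOp_injective B hQH)
    (localOp_injective B hQQ) s hqt
  refine ⟨localOp B U, ?_, ⟨U, rfl⟩, ?_⟩
  · rw [Matrix.mem_unitaryGroup_iff] at hU ⊢
    rw [Matrix.star_eq_conjTranspose, ← localOp_conjTranspose, ← localOp_mul,
      ← Matrix.star_eq_conjTranspose, hU, localOp_one]
  · rw [← localOp_conjTranspose, ← localOp_mul, ← localOp_mul, hUq]
    refine ⟨Matrix.diagonal fun x => if ∀ (i : Fin n) (h : i ∈ Kᶜ), i ∈ B → x ⟨i, h⟩ = 0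
      then 1 else 0, ?_⟩
    ext x y
    simp only [localOp, Matrix.diagonal_apply, hs, Finset.mem_filter, Finset.mem_univ, true_and,
      funext_iff, Subtype.forall, Finset.mem_compl, not_not]
    by_cases hxy : x = y
    · subst hxy
      have : (∀ (i : Fin n), i ∈ B → i ∉ K → x i = 0) ↔ ∀ i, i ∉ K → i ∈ B → x i = 0 :=
        ⟨fun h i a b => h i b a, fun h i a b => h i b a⟩
      simp [this]
    · obtain ⟨i, hi⟩ := Function.ne_iff.1 hxy
      have h1 : ¬ ((∀ i ∈ K, x i = y i) ∧ ∀ i, i ∉ K → x i = y i) := fun h =>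
        hi (by by_cases hK : i ∈ K; exacts [h.1 i hK, h.2 i hK])
      have h2 : ¬ ((∀ i, i ∉ B → x i = y i) ∧ ∀ i ∈ B, x i = y i) := fun h =>
        hi (by by_cases hK : i ∈ B; exacts [h.2 i hK, h.1 i hK])
      rw [← ite_and, if_neg h1]
      split_ifs with ha hb
      · exact absurd ⟨ha, hb⟩ h2
      all_goals rfl

end

/-! ### Purification: outcome records and extraction from one block -/

section

variable {n : ℕ}

/-! ### Syndromes and outcome records -/

/-- The positions in which Alice's and Bob's outcomes differ. -/
def discrepancy (r : List (Bool × Bool)) : List Bool := r.map fun p => p.1 ^^ p.2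

theorem zipWith_xor_eq_iff {r : List (Bool × Bool)} {s : List Bool} (h : s.length = r.length) :
    List.zipWith (· ^^ ·) (r.map Prod.fst) s = r.map Prod.snd ↔ s = discrepancy r := by
  induction r generalizing s with
  | nil => simp_all [discrepancy]
  | cons p r ih =>
    cases s with
    | nil => simp at h
    | cons x s =>
      simp only [List.length_cons, Nat.add_right_cancel_iff] at h
      have := ih h
      simp only [discrepancy] at this
      simp only [List.map_cons, List.zipWith_cons_cons, List.cons.injEq, this, discrepancy]
      obtain ⟨a, b⟩ := p
      cases a <;> cases b <;> cases x <;> simp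

theorem errorDetected_iff (r : List (Bool × Bool)) : ErrorDetected r ↔ true ∈ discrepancy r := by
  simp [ErrorDetected, discrepancy]

theorem exists_sgn_of_errorDetected {r : List (Bool × Bool)} {L : List (Fin n → Pauli)}
    {E : Fin n → Pauli} (h : syndrome L E = discrepancy r) (hr : ErrorDetected r) :
    ∃ M ∈ L, pauliSgn M E = -1 := by
  rw [errorDetected_iff, ← h] at hr
  simpa [syndrome] using hr

theorem sgn_of_not_errorDetected {r : List (Bool × Bool)} {L : List (Fin n → Pauli)}
    {E : Fin n → Pauli} (h : syndrome L E = discrepancy r) (hr : ¬ ErrorDetected r) :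
    ∀ M ∈ L, pauliSgn M E = 1 := by
  rw [errorDetected_iff, ← h] at hr
  intro M hM
  refine (pauliSgn_eq M E).resolve_right fun h => hr ?_
  simpa [syndrome] using ⟨M, hM, h⟩

theorem sgn_eq_of_syndrome_eq {L : List (Fin n → Pauli)} {E F : Fin n → Pauli}
    (h : syndrome L E = syndrome L F) : ∀ M ∈ L, pauliSgn M E = pauliSgn M F := by
  intro M hM
  have h1 := List.map_inj_left.1 h M hM
  rcases pauliSgn_eq M E with h2 | h2 <;> rcases pauliSgn_eq M F with h3 | h3 <;>
    simp_all

theorem jointProj_mul_outcome {L : List (Fin n → Pauli)} (hL : IsRealCommuting L)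
    {r : List (Bool × Bool)} (hr : r.length = L.length) {s : List Bool} (hs : s.length = L.length) :
    jointProj L (List.zipWith (· ^^ ·) (r.map Prod.fst) s) * jointProj L (r.map Prod.snd) =
      if s = discrepancy r then jointProj L (r.map Prod.snd) else 0 := by
  rw [jointProj_mul_self hL (by simp [hr, hs]) (by simp [hr])]
  have h := zipWith_xor_eq_iff (r := r) (s := s) (hs.trans hr.symm)
  by_cases h1 : s = discrepancy r
  · rw [if_pos h1, if_pos (h.2 h1), h.2 h1]
  · rw [if_neg h1, if_neg (fun h2 => h1 (h.1 h2))]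

/-- The unnormalized state after an error and the measurements on two disjoint blocks. -/
theorem jointProj_sandwich {B₁ B₂ : Finset (Fin n)} (hB : Disjoint B₁ B₂)
    {L₁ L₂ : List (Fin n → Pauli)} (h₁ : IsRealCommuting L₁) (h₂ : IsRealCommuting L₂)
    (hL₁ : ∀ M ∈ L₁, ∀ i, i ∉ B₁ → M i = .I) (hL₂ : ∀ M ∈ L₂, ∀ i, i ∉ B₂ → M i = .I)
    {r₁ r₂ : List (Bool × Bool)} (hr₁ : r₁.length = L₁.length) (hr₂ : r₂.length = L₂.length)
    (E : Fin n → Pauli) :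
    jointProj L₂ (r₂.map Prod.fst) * (jointProj L₁ (r₁.map Prod.fst) * pauliOp E *
      (jointProj L₁ (r₁.map Prod.snd))ᵀ) * (jointProj L₂ (r₂.map Prod.snd))ᵀ =
    if syndrome L₁ E = discrepancy r₁ ∧ syndrome L₂ E = discrepancy r₂ then
      pauliOp E * jointProj L₁ (r₁.map Prod.snd) * jointProj L₂ (r₂.map Prod.snd) else 0 := by
  have hc : ∀ s₁ s₂, jointProj L₂ s₂ * jointProj L₁ s₁ = jointProj L₁ s₁ * jointProj L₂ s₂ :=
    fun s₁ s₂ => (localAlg_commute hB.symm (jointProj_mem_localAlg hL₂ s₂)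
      (jointProj_mem_localAlg hL₁ s₁)).eq
  -- Moving `E` to the left shifts Alice's outcomes by the syndrome. Her projector then meets Bob's,
  -- and orthogonality leaves only the case where the shifted outcomes are his.
  rw [jointProj_transpose h₁, jointProj_transpose h₂, jointProj_mul_pauliOp L₁ E (by simp [hr₁]),
    mul_assoc (pauliOp E), jointProj_mul_outcome h₁ hr₁ (by simp [syndrome]), ← mul_assoc,
    jointProj_mul_pauliOp L₂ E (by simp [hr₂])]
  by_cases hs : syndrome L₁ E = discrepancy r₁
  · rw [if_pos hs, mul_assoc (pauliOp E), hc, mul_assoc, mul_assoc,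
      jointProj_mul_outcome h₂ hr₂ (by simp [syndrome])]
    by_cases hs₂ : syndrome L₂ E = discrepancy r₂
    · rw [if_pos hs₂, if_pos ⟨hs, hs₂⟩, mul_assoc]
    · simp [hs₂]
  · simp [hs]

/-! ### Extraction from a block -/

/-- Alice undoes the known error `F` on the block, and both then decode the stabilizer projector
into a state of the block's pairs outside `K`. The factors `X` and `Y` on the other block commute
with the decoder. The hypothesis `hcard` says that the generators use up exactly the pairs of `B`
not in `K`. -/
theorem exists_extraction {B K : Finset (Fin n)} (hKB : K ⊆ B) {L : List (Fin n → Pauli)}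
    (hL : IsRealCommuting L) (hD : HasDestabilizers L) (hLB : ∀ M ∈ L, ∀ i, i ∉ B → M i = .I)
    (hcard : n = n - B.card + K.card + L.length) {b : List Bool} (hb : b.length = L.length)
    {F : Fin n → Pauli} (hF : ∀ i, i ∉ B → F i = .I) :
    ∃ e : Extraction n, e.keep = K ∧ e.From B ∧ ∀ X ∈ localAlg Bᶜ, ∀ Y ∈ localAlg Bᶜ,
      e.UA.1 * (pauliOp F * X * jointProj L b * Y) * (e.UB.1)ᵀ ∈ localAlg Kᶜ := by
  have htr := jointProj_trace hD hb
  have hn : (2 : ℂ) ^ n = 2 ^ (n - B.card) * 2 ^ K.card * 2 ^ L.length := by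
    rw [← pow_add, ← pow_add, ← hcard]
  rw [hn] at htr
  obtain ⟨U, hU, ⟨S, hS⟩, hUQ⟩ := exists_decoder hKB (jointProj_mem_localAlg hLB b)
    (jointProj_conjTranspose hL b) (by rw [jointProj_mul_self hL hb hb, if_pos rfl])
    (mul_right_cancel₀ (pow_ne_zero _ two_ne_zero) htr)
  have hUB : (Uᴴ)ᵀ ∈ Matrix.unitaryGroup (Qubits (Fin n)) ℂ := by
    rw [Matrix.mem_unitaryGroup_iff] at hU ⊢
    have : star (Uᴴᵀ) = Uᵀ := by ext; simp [Matrix.star_apply]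
    rw [this, ← Matrix.transpose_mul]
    exact (congrArg Matrix.transpose hU).trans Matrix.transpose_one
  have hFU : pauliOp F ∈ Matrix.unitaryGroup (Qubits (Fin n)) ℂ := by
    rw [Matrix.mem_unitaryGroup_iff, Matrix.star_eq_conjTranspose, pauliOp_conjTranspose,
      pauliOp_sq]
  -- Bob uses the complex conjugate of `U`, because his operator enters transposed and has to become
  -- `Uᴴ`.
  refine ⟨⟨⟨U * pauliOp F, mul_mem hU hFU⟩, ⟨(Uᴴ)ᵀ, hUB⟩, K⟩, rfl, ⟨hKB, ?_, ?_⟩, ?_⟩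
  · refine ⟨S * pauliTens fun i : B => F i, ?_⟩
    rw [localOp_mul, ← hS, ← exists_localOp_eq_pauliOp B F hF]
  · exact ⟨Sᴴᵀ, by rw [localOp_transpose, localOp_conjTranspose, ← hS]⟩
  · intro X hX Y hY
    have hd : Disjoint Bᶜ B := disjoint_compl_left
    have hXU : X * U = U * X := localAlg_commute hd hX (hS ▸ localOp_mem_localAlg B S)
    have hYU : Y * Uᴴ = Uᴴ * Y := localAlg_commute hd hY
      (hS ▸ localOp_conjTranspose B S ▸ localOp_mem_localAlg B Sᴴ)
    have h : U * pauliOp F * (pauliOp F * X * jointProj L b * Y) * Uᴴᵀᵀ =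
        X * (U * jointProj L b * Uᴴ) * Y := by
      calc _ = U * (pauliOp F * pauliOp F) * X * jointProj L b * (Y * Uᴴ) := by
            simp only [mul_assoc, Matrix.transpose_transpose]
        _ = U * X * jointProj L b * (Uᴴ * Y) := by rw [pauliOp_sq, mul_one, hYU]
        _ = _ := by rw [← hXU]; simp only [mul_assoc]
    change U * pauliOp F * (pauliOp F * X * jointProj L b * Y) * Uᴴᵀᵀ ∈ localAlg Kᶜ
    rw [h]
    have hsub : Bᶜ ⊆ Kᶜ := Finset.compl_subset_compl.2 hKB
    exact mul_mem (mul_mem (localAlg_mono hsub hX) hUQ) (localAlg_mono hsub hY)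

/-! ### The two codes -/

theorem pauliOp_transpose {P : Fin n → Pauli} (h : ∀ i, P i ≠ .Y) : (pauliOp P)ᵀ = pauliOp P := by
  simp [pauliOp_eq, pauliTens_transpose, h]

theorem pauliSgn_nine (P Q : Fin 9 → Pauli) : pauliSgn P Q =
    (P 0).sgn (Q 0) * (P 1).sgn (Q 1) * (P 2).sgn (Q 2) * (P 3).sgn (Q 3) * (P 4).sgn (Q 4) *
      (P 5).sgn (Q 5) * (P 6).sgn (Q 6) * (P 7).sgn (Q 7) * (P 8).sgn (Q 8) := by
  rw [pauliSgn, Fin.prod_univ_castSucc, Fin.prod_univ_eight]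
  rfl

theorem generators_commute : ∀ P ∈ fiveQubitGenerators ++ fourQubitGenerators,
    ∀ Q ∈ fiveQubitGenerators ++ fourQubitGenerators, pauliSgn P Q = 1 := by
  simp [fiveQubitGenerators, fourQubitGenerators, pauliSgn_nine, Pauli.sgn]

theorem generators_real : ∀ P ∈ fiveQubitGenerators ++ fourQubitGenerators, ∀ i, P i ≠ .Y := by
  simp [fiveQubitGenerators, fourQubitGenerators, Fin.forall_fin_succ]

theorem isRealCommuting_five : IsRealCommuting fiveQubitGenerators :=
  ⟨fun P hP Q hQ => generators_commute P (List.mem_append_left _ hP) Q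
    (List.mem_append_left _ hQ),
    fun P hP => pauliOp_transpose (generators_real P (List.mem_append_left _ hP))⟩

theorem isRealCommuting_four : IsRealCommuting fourQubitGenerators :=
  ⟨fun P hP Q hQ => generators_commute P (List.mem_append_right _ hP) Q
    (List.mem_append_right _ hQ),
    fun P hP => pauliOp_transpose (generators_real P (List.mem_append_right _ hP))⟩

theorem fiveQubitGenerators_support :
    ∀ M ∈ fiveQubitGenerators, ∀ i, i ∉ firstFive → M i = .I := by
  simp [fiveQubitGenerators, Fin.forall_fin_succ, firstFive]

theorem fourQubitGenerators_support :
    ∀ M ∈ fourQubitGenerators, ∀ i, i ∉ lastFour → M i = .I := by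
  simp [fourQubitGenerators, Fin.forall_fin_succ, lastFour]

-- The witnesses need to commute only with later generators, so single-qubit operators suffice.
open Pauli in
theorem hasDestabilizers_five : HasDestabilizers fiveQubitGenerators := by
  refine ⟨⟨![I, X, I, I, I, I, I, I, I], ?_⟩, ⟨![I, I, X, I, I, I, I, I, I], ?_⟩,
    ⟨![I, I, I, X, I, I, I, I, I], ?_⟩, ⟨![X, I, I, I, I, I, I, I, I], ?_⟩, trivial⟩ <;>
  simp [pauliSgn_nine, Pauli.sgn]

open Pauli in
theorem hasDestabilizers_four : HasDestabilizers fourQubitGenerators := by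
  refine ⟨⟨![I, I, I, I, I, Z, I, I, I], ?_⟩, ⟨![I, I, I, I, I, X, I, I, I], ?_⟩, trivial⟩ <;>
  simp [pauliSgn_nine, Pauli.sgn]

end

/-! ### The nine-pair protocol: code distances and the three cases -/

section

/-! ### Distances of the two codes -/

/-- The weight of a single-qubit Pauli label. -/
def Pauli.weight : Pauli → ℕ
  | .I => 0
  | _ => 1

/-- The product of Pauli labels up to phase. -/
def Pauli.prod : Pauli → Pauli → Pauli
  | .I, q => q
  | p, .I => p
  | .X, .X | .Y, .Y | .Z, .Z => .I
  | .X, .Y | .Y, .X => .Z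
  | .X, .Z | .Z, .X => .Y
  | .Y, .Z | .Z, .Y => .X

theorem Pauli.weight_eq_zero {p : Pauli} : p.weight = 0 ↔ p = .I := by
  revert p; decide

theorem Pauli.weight_prod_le (p q : Pauli) : (p.prod q).weight ≤ p.weight + q.weight := by
  revert p q; decide

theorem Pauli.prod_eq_I {p q : Pauli} : p.prod q = .I ↔ p = q := by
  revert p q; decide

theorem Pauli.sgn_prod (m p q : Pauli) : m.sgn (p.prod q) = m.sgn p * m.sgn q := by
  revert m p q; decide

theorem pauliSgn_prod {n : ℕ} (M E F : Fin n → Pauli) :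
    pauliSgn M (fun i => (E i).prod (F i)) = pauliSgn M E * pauliSgn M F := by
  simp only [pauliSgn, Pauli.sgn_prod, Finset.prod_mul_distrib]

theorem pauliSgn_of_support {n : ℕ} {B : Finset (Fin n)} {M E : Fin n → Pauli}
    (hM : ∀ i, i ∉ B → M i = .I) (hE : ∀ i ∈ B, E i = .I) : pauliSgn M E = 1 := by
  refine Finset.prod_eq_one fun i _ => ?_
  by_cases hi : i ∈ B
  · rw [hE i hi]
    cases M i <;> rfl
  · rw [hM i hi]
    rfl

/-- The number of qubits in `B` on which a Pauli operator acts nontrivially. -/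
def weightOn {n : ℕ} (B : Finset (Fin n)) (E : Fin n → Pauli) : ℕ := ∑ i ∈ B, (E i).weight

theorem eq_I_of_weightOn {n : ℕ} {B : Finset (Fin n)} {E : Fin n → Pauli}
    (h : weightOn B E = 0) : ∀ i ∈ B, E i = .I := fun i hi =>
  Pauli.weight_eq_zero.1 (Finset.sum_eq_zero_iff.1 h i hi)

-- Distance 3, by exhaustive check. The conditions are interleaved with the quantifiers so that most
-- branches are cut off early.
set_option maxRecDepth 10000 in
theorem five_qubit_distance_aux : ∀ p q r : Pauli, p.weight + q.weight + r.weight ≤ 2 → ∀ s,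
    Pauli.X.sgn p * Pauli.Z.sgn q * Pauli.Z.sgn r * Pauli.X.sgn s = 1 → ∀ t,
    Pauli.X.sgn q * Pauli.Z.sgn r * Pauli.Z.sgn s * Pauli.X.sgn t = 1 →
    Pauli.X.sgn p * Pauli.X.sgn r * Pauli.Z.sgn s * Pauli.Z.sgn t = 1 →
    Pauli.Z.sgn p * Pauli.X.sgn q * Pauli.X.sgn s * Pauli.Z.sgn t = 1 →
    p.weight + q.weight + r.weight + s.weight + t.weight ≤ 2 →
    p = .I ∧ q = .I ∧ r = .I ∧ s = .I ∧ t = .I := by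
  decide

theorem Pauli.I_sgn (p : Pauli) : Pauli.I.sgn p = 1 := rfl

theorem five_qubit_distance {E : Fin 9 → Pauli} (hw : weightOn firstFive E ≤ 2)
    (h : ∀ M ∈ fiveQubitGenerators, pauliSgn M E = 1) : ∀ i ∈ firstFive, E i = .I := by
  simp [fiveQubitGenerators, pauliSgn_nine, Pauli.I_sgn] at h
  simp [weightOn, firstFive] at hw
  have := five_qubit_distance_aux (E 0) (E 1) (E 2) (by omega) (E 3) h.1 (E 4) h.2.1 h.2.2.1
    h.2.2.2 (by omega)
  simpa [firstFive] using this

/-- The product of the two errors has weight at most 2 and trivial syndrome, so it is trivial by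
`five_qubit_distance`. -/
theorem five_qubit_unique {E F : Fin 9 → Pauli} (hE : weightOn firstFive E ≤ 1)
    (hF : weightOn firstFive F ≤ 1)
    (h : ∀ M ∈ fiveQubitGenerators, pauliSgn M E = pauliSgn M F) :
    ∀ i ∈ firstFive, E i = F i := by
  have h1 : weightOn firstFive (fun i => (E i).prod (F i)) ≤ 2 := by
    have : weightOn firstFive (fun i => (E i).prod (F i)) ≤
        weightOn firstFive E + weightOn firstFive F := by
      rw [weightOn, weightOn, weightOn, ← Finset.sum_add_distrib]
      exact Finset.sum_le_sum fun i _ => Pauli.weight_prod_le _ _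
    omega
  have h2 := five_qubit_distance h1 fun M hM => by
    rw [pauliSgn_prod, h M hM]
    rcases pauliSgn_eq M F with h3 | h3 <;> rw [h3] <;> norm_num
  exact fun i hi => Pauli.prod_eq_I.1 (h2 i hi)

-- Distance 2: every single-qubit error anticommutes with `XXXX` or `ZZZZ`.
set_option maxRecDepth 10000 in
theorem four_qubit_distance_aux : ∀ p q r s : Pauli,
    p.weight + q.weight + r.weight + s.weight ≤ 1 →
    Pauli.X.sgn p * Pauli.X.sgn q * Pauli.X.sgn r * Pauli.X.sgn s = 1 →
    Pauli.Z.sgn p * Pauli.Z.sgn q * Pauli.Z.sgn r * Pauli.Z.sgn s = 1 →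
    p = .I ∧ q = .I ∧ r = .I ∧ s = .I := by
  decide

theorem four_qubit_distance {E : Fin 9 → Pauli} (hw : weightOn lastFour E ≤ 1)
    (h : ∀ M ∈ fourQubitGenerators, pauliSgn M E = 1) : ∀ i ∈ lastFour, E i = .I := by
  simp [fourQubitGenerators, pauliSgn_nine, Pauli.I_sgn] at h
  simp [weightOn, lastFour] at hw
  have := four_qubit_distance_aux (E 5) (E 6) (E 7) (E 8) (by omega) h.1 h.2
  simpa [lastFour] using this

theorem compl_firstFive : firstFiveᶜ = lastFour := by decide

theorem compl_lastFour : lastFourᶜ = firstFive := by decide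

theorem disjoint_blocks : Disjoint firstFive lastFour := by decide

theorem weightOn_add_le {T : Finset (Fin 9)} (hT : T.card ≤ 2) {E : Fin 9 → Pauli}
    (hE : ∀ i, i ∉ T → E i = .I) : weightOn firstFive E + weightOn lastFour E ≤ 2 := by
  rw [weightOn, weightOn, ← compl_firstFive, Finset.sum_add_sum_compl]
  refine le_trans ?_ hT
  rw [← Finset.sum_subset (Finset.subset_univ T) fun i _ hi => by rw [hE i hi]; rfl,
    Finset.card_eq_sum_ones]
  refine Finset.sum_le_sum fun i _ => ?_
  cases E i <;> decide

theorem one_le_weightOn_of_errorDetected {n : ℕ} {B : Finset (Fin n)} {L : List (Fin n → Pauli)}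
    (hL : ∀ M ∈ L, ∀ i, i ∉ B → M i = .I) {r : List (Bool × Bool)} {E : Fin n → Pauli}
    (h : syndrome L E = discrepancy r) (hr : ErrorDetected r) : 1 ≤ weightOn B E := by
  obtain ⟨M, hM, hs⟩ := exists_sgn_of_errorDetected h hr
  by_contra hw
  rw [pauliSgn_of_support (hL M hM) (eq_I_of_weightOn (by omega))] at hs
  norm_num at hs

/-! ### The nine-pair protocol -/

/-- The operator that an error `E` followed by the measurements applies to perfect pairs. -/
def branch (r₅ r₄ : List (Bool × Bool)) (A : Matrix (Qubits (Fin 9)) (Qubits (Fin 9)) ℂ) :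
    Matrix (Qubits (Fin 9)) (Qubits (Fin 9)) ℂ :=
  jointProj fourQubitGenerators (r₄.map Prod.fst) * (jointProj fiveQubitGenerators
    (r₅.map Prod.fst) * A * (jointProj fiveQubitGenerators (r₅.map Prod.snd))ᵀ) *
      (jointProj fourQubitGenerators (r₄.map Prod.snd))ᵀ

/-- The extraction recovers perfect pairs from every error of weight at most two. -/
def Recovers (e : Extraction 9) (r₅ r₄ : List (Bool × Bool)) : Prop :=
  ∀ E : Fin 9 → Pauli, weightOn firstFive E + weightOn lastFour E ≤ 2 →
    e.UA.1 * branch r₅ r₄ (pauliOp E) * (e.UB.1)ᵀ ∈ localAlg (e.keep)ᶜ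

theorem recovers_of_branch {e : Extraction 9} {r₅ r₄ : List (Bool × Bool)}
    (h₅ : r₅.length = 4) (h₄ : r₄.length = 2)
    (h : ∀ E : Fin 9 → Pauli, weightOn firstFive E + weightOn lastFour E ≤ 2 →
      syndrome fiveQubitGenerators E = discrepancy r₅ →
      syndrome fourQubitGenerators E = discrepancy r₄ →
      e.UA.1 * (pauliOp E * jointProj fiveQubitGenerators (r₅.map Prod.snd) *
        jointProj fourQubitGenerators (r₄.map Prod.snd)) * (e.UB.1)ᵀ ∈ localAlg (e.keep)ᶜ) :
    Recovers e r₅ r₄ := by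
  intro E hE
  rw [branch, jointProj_sandwich disjoint_blocks isRealCommuting_five isRealCommuting_four
    fiveQubitGenerators_support fourQubitGenerators_support h₅ h₄]
  split_ifs with hs
  · exact h E hE hs.1 hs.2
  · simp

/-- Applies when the record determines the error on the five-qubit block; the error on the other
block may remain unknown. -/
theorem exists_extraction_firstFive {r₅ r₄ : List (Bool × Bool)} (h₅ : r₅.length = 4)
    (h₄ : r₄.length = 2) {F : Fin 9 → Pauli} (hF : ∀ i, i ∉ firstFive → F i = .I)
    (h : ∀ E : Fin 9 → Pauli, weightOn firstFive E + weightOn lastFour E ≤ 2 →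
      syndrome fiveQubitGenerators E = discrepancy r₅ →
      syndrome fourQubitGenerators E = discrepancy r₄ → ∀ i ∈ firstFive, E i = F i) :
    ∃ e : Extraction 9, e.From firstFive ∧ e.keep.card = 1 ∧ Recovers e r₅ r₄ := by
  obtain ⟨e, hK, hB, he⟩ := exists_extraction (B := firstFive) (K := {0}) (by decide)
    isRealCommuting_five hasDestabilizers_five fiveQubitGenerators_support (by decide)
    (b := r₅.map Prod.snd) (by simp [h₅, fiveQubitGenerators]) hF
  refine ⟨e, hB, by rw [hK]; rfl, recovers_of_branch h₅ h₄ fun E hE hs₅ hs₄ => ?_⟩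
  -- The remaining factor of `E` lives on the discarded block and serves as `X` in
  -- `exists_extraction`.
  have hEF : pauliOp E = pauliOp F *
      pauliOp (fun i => if i ∈ firstFive then .I else E i) := by
    simp only [pauliOp_eq, pauliTens, tens_mul]
    congr 1
    funext i
    by_cases hi : i ∈ firstFive
    · simp [hi, h E hE hs₅ hs₄ i hi, Pauli.toMatrix]
    · simp [hi, hF i hi, Pauli.toMatrix]
  rw [hEF, hK]
  refine he _ (pauliOp_mem_localAlg fun i hi => ?_) _ ?_
  · rw [if_pos (by simpa using hi)]
  · rw [compl_firstFive]
    exact jointProj_mem_localAlg fourQubitGenerators_support _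

/-- Nothing needs correcting on the kept block: the whole error and the five-qubit projector act on
the discarded one. -/
theorem exists_extraction_lastFour {r₅ r₄ : List (Bool × Bool)} (h₅ : r₅.length = 4)
    (h₄ : r₄.length = 2)
    (h : ∀ E : Fin 9 → Pauli, weightOn firstFive E + weightOn lastFour E ≤ 2 →
      syndrome fiveQubitGenerators E = discrepancy r₅ →
      syndrome fourQubitGenerators E = discrepancy r₄ → ∀ i ∈ lastFour, E i = .I) :
    ∃ e : Extraction 9, e.From lastFour ∧ e.keep.card = 2 ∧ Recovers e r₅ r₄ := by
  obtain ⟨e, hK, hB, he⟩ := exists_extraction (B := lastFour) (K := {5, 6}) (by decide)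
    isRealCommuting_four hasDestabilizers_four fourQubitGenerators_support (by decide)
    (b := r₄.map Prod.snd) (by simp [h₄, fourQubitGenerators]) (F := fun _ => .I) fun _ _ => rfl
  refine ⟨e, hB, by rw [hK]; rfl, recovers_of_branch h₅ h₄ fun E hE hs₅ hs₄ => ?_⟩
  have hI : pauliOp (fun _ : Fin 9 => Pauli.I) = 1 := tens_one
  have := he (pauliOp E * jointProj fiveQubitGenerators (r₅.map Prod.snd)) (mul_mem
    (pauliOp_mem_localAlg fun i hi => h E hE hs₅ hs₄ i (by simpa using hi))
    (by rw [compl_lastFour]; exact jointProj_mem_localAlg fiveQubitGenerators_support _))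
    1 (one_mem _)
  rwa [hI, one_mul, mul_one, ← hK] at this

/-- A detected error uses up at least one of the two errors allowed, so the other block carries at
most one. The length conditions stand inside the existential so that `choose` later gives a total
function. -/
theorem exists_recovering_extraction (r₅ r₄ : List (Bool × Bool)) :
    ∃ e : Extraction 9, r₅.length = 4 → r₄.length = 2 →
      (1 ≤ e.keep.card ∧ Recovers e r₅ r₄) ∧
      (ErrorDetected r₄ → e.From firstFive ∧ e.keep.card = 1) ∧
      (ErrorDetected r₅ ∧ ¬ ErrorDetected r₄ → e.From lastFour ∧ e.keep.card = 2) ∧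
      (¬ ErrorDetected r₅ ∧ ¬ ErrorDetected r₄ → e.From firstFive ∧ e.keep.card = 1) := by
  by_cases hlen : r₅.length = 4 ∧ r₄.length = 2
  swap
  -- Default value for records of the wrong length, which never occur in the protocol.
  · exact ⟨⟨1, 1, ∅⟩, fun h₅ h₄ => absurd ⟨h₅, h₄⟩ hlen⟩
  obtain ⟨h₅, h₄⟩ := hlen
  by_cases d₄ : ErrorDetected r₄
  · have hw : ∀ E : Fin 9 → Pauli, weightOn firstFive E + weightOn lastFour E ≤ 2 →
        syndrome fourQubitGenerators E = discrepancy r₄ → weightOn firstFive E ≤ 1 := by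
      intro E hE hs₄
      have := one_le_weightOn_of_errorDetected fourQubitGenerators_support hs₄ d₄
      omega
    -- Any error of weight at most 1 on the block with the observed syndrome serves as correction.
    -- If there is none, this record cannot arise from an allowed error.
    obtain ⟨F, hF, hFE⟩ : ∃ F : Fin 9 → Pauli, (∀ i, i ∉ firstFive → F i = .I) ∧
        ∀ E : Fin 9 → Pauli, weightOn firstFive E + weightOn lastFour E ≤ 2 →
          syndrome fiveQubitGenerators E = discrepancy r₅ →
          syndrome fourQubitGenerators E = discrepancy r₄ → ∀ i ∈ firstFive, E i = F i := by
      by_cases hex : ∃ G : Fin 9 → Pauli, weightOn firstFive G ≤ 1 ∧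
          syndrome fiveQubitGenerators G = discrepancy r₅
      · obtain ⟨G, hG, hGs⟩ := hex
        refine ⟨fun i => if i ∈ firstFive then G i else .I, fun i hi => if_neg hi,
          fun E hE hs₅ hs₄ i hi => ?_⟩
        simp only [if_pos hi]
        exact five_qubit_unique (hw E hE hs₄) hG
          (sgn_eq_of_syndrome_eq (hs₅.trans hGs.symm)) i hi
      · exact ⟨fun _ => .I, fun _ _ => rfl, fun E hE hs₅ hs₄ =>
          absurd ⟨E, hw E hE hs₄, hs₅⟩ hex⟩
    obtain ⟨e, hB, hK, hR⟩ := exists_extraction_firstFive h₅ h₄ hF hFE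
    exact ⟨e, fun _ _ => ⟨⟨hK.ge, hR⟩, fun _ => ⟨hB, hK⟩, fun h => absurd d₄ h.2,
      fun h => absurd d₄ h.2⟩⟩
  · by_cases d₅ : ErrorDetected r₅
    · obtain ⟨e, hB, hK, hR⟩ := exists_extraction_lastFour h₅ h₄ fun E hE hs₅ hs₄ =>
        four_qubit_distance (by
          have := one_le_weightOn_of_errorDetected fiveQubitGenerators_support hs₅ d₅
          omega) (sgn_of_not_errorDetected hs₄ d₄)
      exact ⟨e, fun _ _ => ⟨⟨by omega, hR⟩, fun h => absurd h d₄, fun _ => ⟨hB, hK⟩,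
        fun h => absurd d₅ h.1⟩⟩
    · obtain ⟨e, hB, hK, hR⟩ := exists_extraction_firstFive h₅ h₄ (F := fun _ => .I)
        (fun _ _ => rfl) fun E hE hs₅ hs₄ =>
          five_qubit_distance (by omega) (sgn_of_not_errorDetected hs₅ d₅)
      exact ⟨e, fun _ _ => ⟨⟨hK.ge, hR⟩, fun h => absurd h d₄, fun h => absurd h.1 d₅,
        fun _ => ⟨hB, hK⟩⟩⟩

/-- The final matrix depends linearly on the error and the target is a linear subspace, so the Pauli
operators supported in `T` decide the matter for all operators on `T`. -/
theorem Recovers.localOp {e : Extraction 9} {r₅ r₄ : List (Bool × Bool)} (h : Recovers e r₅ r₄)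
    {T : Finset (Fin 9)} (hT : T.card ≤ 2) (S : Matrix (Qubits T) (Qubits T) ℂ) :
    e.UA.1 * branch r₅ r₄ (localOp T S) * (e.UB.1)ᵀ ∈ localAlg (e.keep)ᶜ := by
  let f : Matrix (Qubits (Fin 9)) (Qubits (Fin 9)) ℂ →ₗ[ℂ]
      Matrix (Qubits (Fin 9)) (Qubits (Fin 9)) ℂ :=
    { toFun := fun A => e.UA.1 * branch r₅ r₄ A * (e.UB.1)ᵀ
      map_add' := fun A B => by simp only [branch, mul_add, add_mul]
      map_smul' := fun c A => by simp [branch] }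
  exact localOp_mem T ((Subalgebra.toSubmodule (localAlg (e.keep)ᶜ)).comap f)
    (fun F hF => h F (weightOn_add_le hT hF)) S

/-- The operators already measured accumulate in reverse order, hence `next` is required to work for
every `prev'` contained in `prev ++ L`. -/
theorem commutingAfter_measureAll {n : ℕ} {L : List (Fin n → Pauli)}
    {next : List (Bool × Bool) → TwoEPP n} {prev : List (Fin n → Pauli)}
    (h : ∀ P ∈ prev ++ L, ∀ Q ∈ prev ++ L, pauliSgn P Q = 1)
    (hnext : ∀ r prev', prev' ⊆ prev ++ L → (next r).CommutingAfter prev') :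
    (TwoEPP.measureAll L next).CommutingAfter prev := by
  induction L generalizing next prev with
  | nil => exact hnext [] prev (by simp)
  | cons M L ih =>
    refine ⟨fun P hP => pauliOp_commute (h P (by simp [hP]) M (by simp)), fun a b => ih ?_ ?_⟩
    · intro P hP Q hQ
      exact h P (by simp at hP ⊢; tauto) Q (by simp at hQ ⊢; tauto)
    · intro r prev' hp
      refine hnext _ _ fun P hP => ?_
      have := hp hP
      simp at this ⊢
      tauto

theorem nine_pair_protocol :
    ∃ (D : List (Bool × Bool) → List (Bool × Bool) → Extraction 9) (π : TwoEPP 9),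
      π = TwoEPP.measureAll fiveQubitGenerators (fun r₅ =>
            TwoEPP.measureAll fourQubitGenerators (fun r₄ => TwoEPP.extract (D r₅ r₄))) ∧
      π.Commuting ∧
      π.Produces 1 2 ∧
      ∀ r₅ r₄ : List (Bool × Bool), r₅.length = 4 → r₄.length = 2 →
        (ErrorDetected r₄ → (D r₅ r₄).From firstFive ∧ (D r₅ r₄).keep.card = 1) ∧
        (ErrorDetected r₅ ∧ ¬ ErrorDetected r₄ →
          (D r₅ r₄).From lastFour ∧ (D r₅ r₄).keep.card = 2) ∧
        (¬ ErrorDetected r₅ ∧ ¬ ErrorDetected r₄ →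
          (D r₅ r₄).From firstFive ∧ (D r₅ r₄).keep.card = 1) := by
  choose D hD using exists_recovering_extraction
  refine ⟨D, _, rfl, ?_, ?_, fun r₅ r₄ h₅ h₄ => (hD r₅ r₄ h₅ h₄).2⟩
  · refine commutingAfter_measureAll (fun P hP Q hQ => isRealCommuting_five.1 P hP Q hQ)
      fun r prev' hp => commutingAfter_measureAll (fun P hP Q hQ => ?_) fun _ _ _ => trivial
    have hsub : prev' ++ fourQubitGenerators ⊆ fiveQubitGenerators ++ fourQubitGenerators :=
      List.append_subset.2 ⟨List.Subset.trans hp (List.subset_append_left _ _), List.subset_append_right _ _⟩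
    exact generators_commute P (hsub hP) Q (hsub hQ)
  · intro T hT m S _
    rw [applyKraus_eprState]
    refine succeeds_measureAll _ _ _ fun r₅ h₅ => succeeds_measureAll _ _ _ fun r₄ h₄ => ?_
    have h := (hD r₅ r₄ h₅ h₄).1
    exact succeeds_extract _ _ h.1 fun i => h.2.localOp hT _

end

end EPP

end

theorem mainTheorem5 :
    (∃ (D : List (Bool × Bool) → List (Bool × Bool) → EPP.Extraction 9) (π : EPP.TwoEPP 9),
      π = EPP.TwoEPP.measureAll EPP.fiveQubitGenerators (fun r₅ =>
            EPP.TwoEPP.measureAll EPP.fourQubitGenerators (fun r₄ =>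
              EPP.TwoEPP.extract (D r₅ r₄))) ∧
      π.Commuting ∧
      π.Produces 1 2 ∧
      ∀ r₅ r₄ : List (Bool × Bool), r₅.length = 4 → r₄.length = 2 →
        (EPP.ErrorDetected r₄ →
          (D r₅ r₄).From EPP.firstFive ∧ (D r₅ r₄).keep.card = 1) ∧
        (EPP.ErrorDetected r₅ ∧ ¬ EPP.ErrorDetected r₄ →
          (D r₅ r₄).From EPP.lastFour ∧ (D r₅ r₄).keep.card = 2) ∧
        (¬ EPP.ErrorDetected r₅ ∧ ¬ EPP.ErrorDetected r₄ →
          (D r₅ r₄).From EPP.firstFive ∧ (D r₅ r₄).keep.card = 1)) ∧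
    (∀ n : ℕ, EPP.QuantumHammingBound n 1 2 ↔ 10 ≤ n) ∧
    (∀ n : ℕ, EPP.ExistsQECC n 1 2 → 11 ≤ n) := by
  exact ⟨EPP.nine_pair_protocol, EPP.quantumHammingBound_iff, EPP.le_of_existsQECC⟩
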